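/- Let $\mathbb{k}=\mathbb{R}$ or $\mathbb{C}$, let $x,y,u_{ij}$ ($i,j\ge 0$) be the canonical coordinates on jets of functions $f$ on the plane $\mathbb{k}^2$, with $u_{ij}([f]_p)=\frac{\partial^{i+j}f}{\partial x^i\partial y^j}(p)$, and let $\mathcal F$ be the field of rational functions over $\mathbb{k}$ in finitely many of these coordinates. A function $F\in\mathcal F$ is called a rational affine differential invariant if for every $A\in\mathrm{Aff}_2(\mathbb{k})$, every smooth $f$ (holomorphic if $\mathbb{k}=\mathbb{C}$) and every point $p$, $F$ takes the same value at the jet of $f$ at $p$ and at the jet of $f\circ A^{-1}$ at $A(p)$ whenever it is defined at both. Let $\frac{d}{dx}=\frac{\partial}{\partial x}+\sum u_{i+1,j}\frac{\partial}{\partial u_{ij}}$ and $\frac{d}{dy}=\frac{\partial}{\partial y}+\sum u_{i,j+1}\frac{\partial}{\partial u_{ij}}$ be the total derivatives, $\widehat dF=\frac{dF}{dx}dx+\frac{dF}{dy}dy$ the total differential, $$I_2=\frac{u_{01}^2u_{20}-2u_{10}u_{01}u_{11}+u_{10}^2u_{02}}{u_{20}u_{02}-u_{11}^2},\qquad \omega_1=\widehat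 d u_{00},\quad \omega_2=\widehat d I_2,$$ and let $$\Theta_k=\sum_{i=0}^k u_{i,k-i}\frac{dx^i}{i!}\frac{dy^{k-i}}{(k-i)!}\qquad(k\ge 0)$$ be symmetric forms in $dx,dy$ with coefficients in $\mathcal F$. **Theorem.** The forms $\omega_1,\omega_2$ are linearly independent over $\mathcal F$, there are unique $I_{ij}\in\mathcal F$ ($i,j\ge0$) with $$\Theta_k=\sum_{i=0}^k I_{i,k-i}\frac{\omega_1^i}{i!}\frac{\omega_2^{k-i}}{(k-i)!}\qquad\text{for all }k\ge0,$$ and the rational affine differential invariants are exactly the rational functions over $\mathbb{k}$ of the $I_{ij}$; that is, they form the field $\mathbb{k}(I_{ij}: i,j\ge 0)$. -/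

import Mathlib

open scoped ContDiff

noncomputable section

namespace AffJet

/-- The canonical coordinates `x, y, u i j` (`i, j ≥ 0`) on the jets of functions on the plane. -/
inductive JetVar : Type
  | x : JetVar
  | y : JetVar
  | u (i j : ℕ) : JetVar

/-- Polynomial functions on jets. Every polynomial involves finitely many coordinates, so it lives
on the space of `k`-jets for some `k`. -/
abbrev JetPoly (𝕜 : Type*) [Field 𝕜] : Type _ := MvPolynomial JetVar 𝕜

/-- The field of rational functions on jets (of arbitrary finite order). -/
abbrev JetField (𝕜 : Type*) [Field 𝕜] : Type _ := FractionRing (JetPoly 𝕜)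

section Jets

variable {𝕜 : Type*} [RCLike 𝕜]

/-- The partial derivative `∂/∂x` of a function on the plane. -/
def partialX (f : 𝕜 × 𝕜 → 𝕜) : 𝕜 × 𝕜 → 𝕜 := fun p => fderiv 𝕜 f p (1, 0)

/-- The partial derivative `∂/∂y` of a function on the plane. -/
def partialY (f : 𝕜 × 𝕜 → 𝕜) : 𝕜 × 𝕜 → 𝕜 := fun p => fderiv 𝕜 f p (0, 1)

/-- The jet of `f` at `p` in canonical coordinates:
`u i j` takes the value `∂^{i+j} f / ∂x^i ∂y^j (p)`. -/
def jet (f : 𝕜 × 𝕜 → 𝕜) (p : 𝕜 × 𝕜) : JetVar → 𝕜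
  | .x => p.1
  | .y => p.2
  | .u i j => (partialX^[i] (partialY^[j] f)) p

/-- The rational function `F` is defined at the jet `z` and takes the value `c` there:
`F = P / Q` for polynomials `P, Q` with `Q z ≠ 0` and `c = P z / Q z`. -/
def HasValueAt (F : JetField 𝕜) (z : JetVar → 𝕜) (c : 𝕜) : Prop :=
  ∃ P Q : JetPoly 𝕜, MvPolynomial.eval z Q ≠ 0 ∧
    F = algebraMap (JetPoly 𝕜) (JetField 𝕜) P / algebraMap (JetPoly 𝕜) (JetField 𝕜) Q ∧
    c = MvPolynomial.eval z P / MvPolynomial.eval z Q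

/-- `F` is a rational differential invariant of the affine group of the plane. The prolongation of
an affine transformation `A` maps the jet of `f` at `p` to the jet of `A f = f ∘ A⁻¹` at `A p`;
invariance says that `F` takes equal values at these two jets whenever it is defined at both. -/
def IsAffineInvariant (F : JetField 𝕜) : Prop :=
  ∀ (A : (𝕜 × 𝕜) ≃ᵃ[𝕜] (𝕜 × 𝕜)) (f : 𝕜 × 𝕜 → 𝕜), ContDiff 𝕜 ∞ f → ∀ (p : 𝕜 × 𝕜) (c c' : 𝕜),
    HasValueAt F (jet f p) c → HasValueAt F (jet (f ∘ A.symm) (A p)) c' → c' = c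

end Jets

variable (𝕜 : Type*) [Field 𝕜]

/-- The coordinate `u i j` as a rational function. -/
def u (i j : ℕ) : JetField 𝕜 := algebraMap (JetPoly 𝕜) (JetField 𝕜) (MvPolynomial.X (.u i j))

/-- The total derivative `d/dx = ∂/∂x + ∑ u_{i+1,j} ∂/∂u_{ij}` on polynomials. -/
def polyDx : Derivation 𝕜 (JetPoly 𝕜) (JetPoly 𝕜) :=
  MvPolynomial.mkDerivation 𝕜 fun v => match v with
    | .x => 1
    | .y => 0
    | .u i j => MvPolynomial.X (.u (i + 1) j)

/-- The total derivative `d/dy = ∂/∂y + ∑ u_{i,j+1} ∂/∂u_{ij}` on polynomials. -/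
def polyDy : Derivation 𝕜 (JetPoly 𝕜) (JetPoly 𝕜) :=
  MvPolynomial.mkDerivation 𝕜 fun v => match v with
    | .x => 0
    | .y => 1
    | .u i j => MvPolynomial.X (.u i (j + 1))

variable {𝕜}

/-- The extension of a derivation of the polynomials to the rational functions, by the quotient
rule. -/
def extendDer (D : Derivation 𝕜 (JetPoly 𝕜) (JetPoly 𝕜)) (F : JetField 𝕜) : JetField 𝕜 :=
  let P : JetPoly 𝕜 := (IsLocalization.sec (nonZeroDivisors (JetPoly 𝕜)) F).1
  let Q : JetPoly 𝕜 := (IsLocalization.sec (nonZeroDivisors (JetPoly 𝕜)) F).2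
  algebraMap (JetPoly 𝕜) (JetField 𝕜) (D P * Q - P * D Q) /
    algebraMap (JetPoly 𝕜) (JetField 𝕜) (Q ^ 2)

/-- The quotient rule holds for every representation of a rational function as a fraction. -/
theorem extendDer_div (D : Derivation 𝕜 (JetPoly 𝕜) (JetPoly 𝕜)) (P Q : JetPoly 𝕜) (hQ : Q ≠ 0) :
    extendDer D (algebraMap (JetPoly 𝕜) (JetField 𝕜) P / algebraMap (JetPoly 𝕜) (JetField 𝕜) Q) =
      algebraMap (JetPoly 𝕜) (JetField 𝕜) (D P * Q - P * D Q) /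
        algebraMap (JetPoly 𝕜) (JetField 𝕜) (Q ^ 2) := by
  set F := algebraMap (JetPoly 𝕜) (JetField 𝕜) P / algebraMap (JetPoly 𝕜) (JetField 𝕜) Q with hF
  have hinj : Function.Injective (algebraMap (JetPoly 𝕜) (JetField 𝕜)) :=
    IsFractionRing.injective _ _
  have hspec := IsLocalization.sec_spec (nonZeroDivisors (JetPoly 𝕜)) F
  set P' : JetPoly 𝕜 := (IsLocalization.sec (nonZeroDivisors (JetPoly 𝕜)) F).1 with hP'
  have hQ' : ((IsLocalization.sec (nonZeroDivisors (JetPoly 𝕜)) F).2 : JetPoly 𝕜) ≠ 0 :=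
    nonZeroDivisors.ne_zero (IsLocalization.sec (nonZeroDivisors (JetPoly 𝕜)) F).2.2
  simp only [extendDer]
  rw [← hP']
  generalize ((IsLocalization.sec (nonZeroDivisors (JetPoly 𝕜)) F).2 : JetPoly 𝕜) = Q' at *
  have h0 : algebraMap (JetPoly 𝕜) (JetField 𝕜) Q ≠ 0 := fun h => hQ (hinj (by simpa using h))
  have h1 : algebraMap (JetPoly 𝕜) (JetField 𝕜) Q' ≠ 0 := fun h => hQ' (hinj (by simpa using h))
  have key : P * Q' = P' * Q := by
    apply hinj
    rw [hF] at hspec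
    field_simp at hspec
    rw [map_mul, map_mul]
    linear_combination hspec
  have dkey := congrArg D key
  simp only [Derivation.leibniz, smul_eq_mul] at dkey
  rw [div_eq_div_iff (by rw [map_pow]; exact pow_ne_zero 2 h1)
    (by rw [map_pow]; exact pow_ne_zero 2 h0), ← map_mul, ← map_mul]
  congr 1
  linear_combination (-Q * Q') * dkey + (Q' * D Q + Q * D Q') * key

/-- A horizontal symmetric form `∑ a_{ij} dx^i dy^j` with rational coefficients,
as a polynomial in the two symbols `dx` and `dy`. -/
abbrev HForm (𝕜 : Type*) [Field 𝕜] : Type _ := MvPolynomial (Fin 2) (JetField 𝕜)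

/-- The total differential `dF/dx · dx + dF/dy · dy`. -/
def totalDiff (F : JetField 𝕜) : HForm 𝕜 :=
  MvPolynomial.C (extendDer (polyDx 𝕜) F) * MvPolynomial.X 0 +
    MvPolynomial.C (extendDer (polyDy 𝕜) F) * MvPolynomial.X 1

variable (𝕜)

/-- The symmetric tensor `Θ_k = ∑_{i=0}^k u_{i,k-i} dx^i / i! · dy^{k-i} / (k-i)!`. -/
def Theta (k : ℕ) : HForm 𝕜 :=
  ∑ i ∈ Finset.range (k + 1),
    MvPolynomial.C
        (u 𝕜 i (k - i) / ((i.factorial : JetField 𝕜) * ((k - i).factorial : JetField 𝕜))) *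
      (MvPolynomial.X 0 ^ i * MvPolynomial.X 1 ^ (k - i))

/-- The second order invariant
`I₂ = (u₀₁² u₂₀ - 2 u₁₀ u₀₁ u₁₁ + u₁₀² u₀₂) / (u₂₀ u₀₂ - u₁₁²)`. -/
def I2 : JetField 𝕜 :=
  (u 𝕜 0 1 ^ 2 * u 𝕜 2 0 - 2 * u 𝕜 1 0 * u 𝕜 0 1 * u 𝕜 1 1 + u 𝕜 1 0 ^ 2 * u 𝕜 0 2) /
    (u 𝕜 2 0 * u 𝕜 0 2 - u 𝕜 1 1 ^ 2)

/-- The first form of the Tresse coframe. -/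
def omega1 : HForm 𝕜 := totalDiff (u 𝕜 0 0)

/-- The second form of the Tresse coframe. -/
def omega2 : HForm 𝕜 := totalDiff (I2 𝕜)

variable {𝕜}

/-- `I i j` are the coefficients of the tensors `Θ_k` in the Tresse coframe:
`Θ_k = ∑_{i=0}^k I_{i,k-i} ω₁^i / i! · ω₂^{k-i} / (k-i)!` for all `k ≥ 0`. -/
def AreTresseCoeffs (I : ℕ → ℕ → JetField 𝕜) : Prop :=
  ∀ k : ℕ, Theta 𝕜 k = ∑ i ∈ Finset.range (k + 1),
    MvPolynomial.C
        (I i (k - i) / ((i.factorial : JetField 𝕜) * ((k - i).factorial : JetField 𝕜))) *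
      (omega1 𝕜 ^ i * omega2 𝕜 ^ (k - i))

end AffJet

end

/-!
Write a jet as a linear functional on polynomials in two symbols, `X₀ ^ i * X₁ ^ j ↦ u i j`
(`pairing`). An affine map acts on jets by a linear substitution of the symbols (`moved`, with the
base point included `prolong`; the chain rule is `jet_comp_symm`), and `k! Θ_k` is the value of the
functional at `(X₀ dx + X₁ dy) ^ k`. Rewriting `dx`, `dy` in another pair of linear forms therefore
substitutes linearly in the symbols as well (`taylor_change_of_frame`). So if `ω₁, ω₂` is a coframe,
that is, if its determinant is not the zero function (`coframeDet_ne_zero`, by evaluation at one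
jet), then the coefficients `I i j` exist, are unique, and are the Taylor coefficients `u i j` moved
by the inverse of the coframe matrix (`tresseCoeff`).

Rational functions of the `I i j` are invariant: an affine map pulls back `u₀₀` and `I₂` to
themselves, so by the chain rule for total derivatives it multiplies the coframe matrix by the
matrix by which it moves the Taylor coefficients, and the two changes cancel
(`fieldPullback_tresseCoeff`). An element of the function field that is fixed by all pull-backs is
invariant pointwise (`isAffineInvariant_of_fixed`).

Conversely, let `F = P / Q` be invariant. Every finite part of a jet comes from a polynomial, so
invariance amounts to an identity `P(g z) Q(z) = Q(g z) P(z)` of polynomials in the jet `z` and the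
coefficients of the affine map `g` (`IsAffineInvariant.generic_identity`). There `g` may be given
coefficients in the function field itself: take the inverse of the coframe followed by a map `g₀`
over `𝕜`, which gives `F = P(g₀ I) / Q(g₀ I)`, a rational function of the `I i j`. The denominator
might vanish for `g₀ = 1`, but not for all `g₀`: as a polynomial in `g₀` it is nonzero, since at the
coframe itself it is `Q` (`prolong_coframe_framedJet`).
-/

noncomputable section

namespace AffJet

open MvPolynomial

/-! ### Taylor coefficients as functionals on polynomials -/

section Pairing

variable {R S : Type*} [CommRing R] [CommRing S]

/-- The linear functional on polynomials in two variables that takes the value `z i j` at the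
monomial `X₀ ^ i * X₁ ^ j`. -/
def pairing (z : ℕ → ℕ → R) : MvPolynomial (Fin 2) R →ₗ[R] R :=
  (basisMonomials (Fin 2) R).constr R fun m => z (m 0) (m 1)

theorem pairing_monomial (z : ℕ → ℕ → R) (m : Fin 2 →₀ ℕ) (r : R) :
    pairing z (monomial m r) = r * z (m 0) (m 1) := by
  have h : (monomial m r : MvPolynomial (Fin 2) R) = r • basisMonomials (Fin 2) R m := by
    simp [smul_monomial]
  rw [h, map_smul, pairing, Module.Basis.constr_basis, smul_eq_mul]

theorem X_pow_mul_X_pow (i j : ℕ) :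
    (X 0 ^ i * X 1 ^ j : MvPolynomial (Fin 2) R) =
      monomial (Finsupp.single 0 i + Finsupp.single 1 j) 1 := by
  simp [X_pow_eq_monomial, monomial_mul]

theorem monomial_eq_C_mul_X_pow (m : Fin 2 →₀ ℕ) (r : R) :
    (monomial m r : MvPolynomial (Fin 2) R) = r • (X 0 ^ m 0 * X 1 ^ m 1) := by
  rw [X_pow_mul_X_pow, smul_monomial, smul_eq_mul, mul_one]
  have h : m = Finsupp.single 0 (m 0) + Finsupp.single 1 (m 1) := by
    refine Finsupp.ext fun k => ?_
    fin_cases k <;> simp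
  rw [← h]

@[simp]
theorem pairing_X_pow (z : ℕ → ℕ → R) (i j : ℕ) :
    pairing z (X 0 ^ i * X 1 ^ j) = z i j := by
  rw [X_pow_mul_X_pow, pairing_monomial]
  simp

theorem linearMap_ext_X_pow {M : Type*} [AddCommGroup M] [Module R M]
    {f g : MvPolynomial (Fin 2) R →ₗ[R] M}
    (h : ∀ i j, f (X 0 ^ i * X 1 ^ j) = g (X 0 ^ i * X 1 ^ j)) : f = g := by
  refine LinearMap.ext fun q => ?_
  induction q using MvPolynomial.induction_on' with
  | monomial m r => rw [monomial_eq_C_mul_X_pow, map_smul, map_smul, h]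
  | add p q hp hq => rw [map_add, map_add, hp, hq]

theorem map_pairing (φ : R →+* S) (z : ℕ → ℕ → R) (q : MvPolynomial (Fin 2) R) :
    φ (pairing z q) = pairing (fun i j => φ (z i j)) (map φ q) := by
  induction q using MvPolynomial.induction_on' with
  | monomial m r => simp [pairing_monomial]
  | add p q hp hq => simp only [map_add, hp, hq]

/-- The linear substitution `X₀ ↦ a X₀ + b X₁`, `X₁ ↦ c X₀ + d X₁`. -/
def linSubst (a b c d : R) : MvPolynomial (Fin 2) R →ₐ[R] MvPolynomial (Fin 2) R :=
  aeval ![C a * X 0 + C b * X 1, C c * X 0 + C d * X 1]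

@[simp]
theorem linSubst_X_zero (a b c d : R) : linSubst a b c d (X 0) = C a * X 0 + C b * X 1 := by
  simp [linSubst]

@[simp]
theorem linSubst_X_one (a b c d : R) : linSubst a b c d (X 1) = C c * X 0 + C d * X 1 := by
  simp [linSubst]

/-- The linear action of 2 × 2 matrices on Taylor coefficients: if `z i j` are the partial
derivatives of a function `f` at a point, then `moved a b c d z` are those of `f ∘ B` at the
preimage of the point under the linear map `B` with `B (1, 0) = (a, b)` and `B (0, 1) = (c, d)`. -/
def moved (a b c d : R) (z : ℕ → ℕ → R) (i j : ℕ) : R :=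
  pairing z ((C a * X 0 + C b * X 1) ^ i * (C c * X 0 + C d * X 1) ^ j)

theorem pairing_moved (a b c d : R) (z : ℕ → ℕ → R) (q : MvPolynomial (Fin 2) R) :
    pairing (moved a b c d z) q = pairing z (linSubst a b c d q) := by
  have h : pairing (moved a b c d z) = pairing z ∘ₗ (linSubst a b c d).toLinearMap := by
    refine linearMap_ext_X_pow fun i j => ?_
    simp [moved]
  rw [h]
  rfl

theorem moved_moved (a b c d a' b' c' d' : R) (z : ℕ → ℕ → R) :
    moved a' b' c' d' (moved a b c d z) =
      moved (a' * a + b' * c) (a' * b + b' * d) (c' * a + d' * c) (c' * b + d' * d) z := by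
  funext i j
  rw [moved, pairing_moved, moved]
  congr 1
  simp only [map_mul, map_pow, map_add, linSubst_X_zero, linSubst_X_one, algHom_C, algebraMap_eq]
  congr 2 <;> ring

theorem moved_one (z : ℕ → ℕ → R) : moved 1 0 0 1 z = z := by
  funext i j
  simp [moved]

theorem map_moved (φ : R →+* S) (a b c d : R) (z : ℕ → ℕ → R) (i j : ℕ) :
    φ (moved a b c d z i j) =
      moved (φ a) (φ b) (φ c) (φ d) (fun i j => φ (z i j)) i j := by
  simp [moved, map_pairing]

end Pairing

/-! ### Change of frame in symmetric forms -/

section Taylor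

variable {K : Type*} [Field K] [CharZero K]

/-- The divided power form of the `k`-th Taylor term: pairing with the `k`-th power of
`l p + m q` gives `k!` times the symmetric form in `p`, `q` whose coefficients are the pairings
with `l ^ i * m ^ (k - i)`. -/
theorem pairing_add_pow (z : ℕ → ℕ → K) (l m p q : MvPolynomial (Fin 2) K) (k : ℕ) :
    pairing (fun i j => (C (z i j) : MvPolynomial (Fin 2) K))
        ((map (C : K →+* MvPolynomial (Fin 2) K) l * C p + map C m * C q) ^ k) =
      C (k.factorial : K) * ∑ i ∈ Finset.range (k + 1),
        C (pairing z (l ^ i * m ^ (k - i)) / ((i.factorial : K) * ((k - i).factorial : K))) *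
          (p ^ i * q ^ (k - i)) := by
  rw [add_pow, map_sum, Finset.mul_sum]
  refine Finset.sum_congr rfl fun i hi => ?_
  have hik : i ≤ k := Nat.lt_succ_iff.mp (Finset.mem_range.mp hi)
  have e : (map (C : K →+* MvPolynomial (Fin 2) K) l * C p) ^ i * (map C m * C q) ^ (k - i) *
      ((k.choose i : ℕ) : MvPolynomial (Fin 2) (MvPolynomial (Fin 2) K)) =
      (p ^ i * q ^ (k - i) * C (k.choose i : K)) •
        map (C : K →+* MvPolynomial (Fin 2) K) (l ^ i * m ^ (k - i)) := by
    rw [smul_eq_C_mul]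
    simp only [map_mul, map_pow, map_natCast]
    ring
  rw [e, map_smul, ← map_pairing, smul_eq_mul, Nat.cast_choose K hik]
  have hC : (C ((k.factorial : K) / ((i.factorial : K) * ((k - i).factorial : K))) :
        MvPolynomial (Fin 2) K) * C (pairing z (l ^ i * m ^ (k - i))) =
      C (k.factorial : K) *
        C (pairing z (l ^ i * m ^ (k - i)) / ((i.factorial : K) * ((k - i).factorial : K))) := by
    rw [← C_mul, ← C_mul]
    congr 1
    ring
  linear_combination p ^ i * q ^ (k - i) * hC

/-- Rewriting a Taylor form in another pair of linear forms moves the coefficients by the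
transposed matrix, because `X₀ p + X₁ q = (α X₀ + γ X₁) p' + (β X₀ + δ X₁) q'`. -/
theorem taylor_change_of_frame (z : ℕ → ℕ → K) (α β γ δ : K) {p q p' q' : MvPolynomial (Fin 2) K}
    (hp : p = C α * p' + C β * q') (hq : q = C γ * p' + C δ * q') (k : ℕ) :
    ∑ i ∈ Finset.range (k + 1),
        C (z i (k - i) / ((i.factorial : K) * ((k - i).factorial : K))) *
          (p ^ i * q ^ (k - i)) =
      ∑ i ∈ Finset.range (k + 1),
        C (moved α γ β δ z i (k - i) / ((i.factorial : K) * ((k - i).factorial : K))) *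
          (p' ^ i * q' ^ (k - i)) := by
  have h1 := pairing_add_pow z (X 0) (X 1) p q k
  have h2 := pairing_add_pow z (C α * X 0 + C γ * X 1) (C β * X 0 + C δ * X 1) p' q' k
  have e : map (C : K →+* MvPolynomial (Fin 2) K) (X (0 : Fin 2)) * C p + map C (X 1) * C q =
      map C (C α * X 0 + C γ * X 1) * C p' + map C (C β * X 0 + C δ * X 1) * C q' := by
    simp only [map_add, map_mul, map_C, map_X, hp, hq]
    ring
  rw [e, h2] at h1
  have hk : (C (k.factorial : K) : MvPolynomial (Fin 2) K) ≠ 0 := by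
    rw [Ne, C_eq_zero]
    exact_mod_cast k.factorial_ne_zero
  have h3 := mul_left_cancel₀ hk h1
  simp only [pairing_X_pow] at h3
  exact h3.symm

/-- The coefficients of a form of degree `k` in two linear forms are determined by the form once
the linear forms can be inverted. -/
theorem taylor_coeff_unique {p q : MvPolynomial (Fin 2) K} {α β γ δ : K}
    (hp : X 0 = C α * p + C β * q) (hq : X 1 = C γ * p + C δ * q)
    (hdet : α * δ - β * γ ≠ 0) {I J : ℕ → ℕ → K}
    (h : ∀ k, ∑ i ∈ Finset.range (k + 1),
        C (I i (k - i) / ((i.factorial : K) * ((k - i).factorial : K))) * (p ^ i * q ^ (k - i)) =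
      ∑ i ∈ Finset.range (k + 1),
        C (J i (k - i) / ((i.factorial : K) * ((k - i).factorial : K))) * (p ^ i * q ^ (k - i))) :
    I = J := by
  have key : ∀ (J : ℕ → ℕ → K) (i j : ℕ), coeff (Finsupp.single 0 i + Finsupp.single 1 j)
      (∑ l ∈ Finset.range (i + j + 1),
        C (J l (i + j - l) / ((l.factorial : K) * ((i + j - l).factorial : K))) *
          ((X 0 : MvPolynomial (Fin 2) K) ^ l * X 1 ^ (i + j - l))) =
      J i j / ((i.factorial : K) * (j.factorial : K)) := by
    intro J i j
    rw [coeff_sum, Finset.sum_eq_single i]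
    · rw [X_pow_mul_X_pow, Nat.add_sub_cancel_left, coeff_C_mul, coeff_monomial, if_pos rfl,
        mul_one]
    · intro l _ hl
      rw [X_pow_mul_X_pow, coeff_C_mul, coeff_monomial, if_neg, mul_zero]
      intro he
      have := DFunLike.congr_fun he 0
      simp at this
      exact hl this
    · intro hi
      exact absurd (Finset.mem_range.mpr (by omega)) hi
  -- The substitution inverse to `X 0 ↦ p`, `X 1 ↦ q`.
  let σ : MvPolynomial (Fin 2) K →ₐ[K] MvPolynomial (Fin 2) K := linSubst α β γ δ
  have h0 : C (α * δ - β * γ) * p = C δ * X 0 - C β * X 1 := by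
    rw [hp, hq]; simp only [map_sub, map_mul]; ring
  have h1 : C (α * δ - β * γ) * q = C α * X 1 - C γ * X 0 := by
    rw [hp, hq]; simp only [map_sub, map_mul]; ring
  have hC : (C (α * δ - β * γ) : MvPolynomial (Fin 2) K) ≠ 0 := by rwa [Ne, C_eq_zero]
  have σp : σ p = X 0 := by
    have := congrArg σ h0
    simp only [σ, map_mul, map_sub, linSubst_X_zero, linSubst_X_one, algHom_C,
      algebraMap_eq] at this
    refine mul_left_cancel₀ hC ?_
    simp only [σ, map_mul, map_sub]
    rw [this]; ring
  have σq : σ q = X 1 := by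
    have := congrArg σ h1
    simp only [σ, map_mul, map_sub, linSubst_X_zero, linSubst_X_one, algHom_C,
      algebraMap_eq] at this
    refine mul_left_cancel₀ hC ?_
    simp only [σ, map_mul, map_sub]
    rw [this]; ring
  funext i j
  have hk := congrArg σ (h (i + j))
  simp only [map_sum, map_mul σ, map_pow, σp, σq, algHom_C, algebraMap_eq] at hk
  have := congrArg (coeff (Finsupp.single 0 i + Finsupp.single 1 j)) hk
  rw [key, key] at this
  have hi : (i.factorial : K) ≠ 0 := by exact_mod_cast i.factorial_ne_zero
  have hj : (j.factorial : K) ≠ 0 := by exact_mod_cast j.factorial_ne_zero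
  exact (div_left_inj' (mul_ne_zero hi hj)).mp this

end Taylor

/-! ### Partial derivatives and affine changes of coordinates -/

section JetCalculus

variable {𝕜 : Type*} [RCLike 𝕜]

theorem contDiff_partialX {f : 𝕜 × 𝕜 → 𝕜} (hf : ContDiff 𝕜 ∞ f) : ContDiff 𝕜 ∞ (partialX f) :=
  (hf.fderiv_right (m := ∞) le_rfl).clm_apply contDiff_const

theorem contDiff_partialY {f : 𝕜 × 𝕜 → 𝕜} (hf : ContDiff 𝕜 ∞ f) : ContDiff 𝕜 ∞ (partialY f) :=
  (hf.fderiv_right (m := ∞) le_rfl).clm_apply contDiff_const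

theorem contDiff_iterate_partial {f : 𝕜 × 𝕜 → 𝕜} (hf : ContDiff 𝕜 ∞ f) (i j : ℕ) :
    ContDiff 𝕜 ∞ (partialX^[i] (partialY^[j] f)) := by
  have hj : ContDiff 𝕜 ∞ (partialY^[j] f) := by
    induction j with
    | zero => exact hf
    | succ j ih => rw [Function.iterate_succ_apply']; exact contDiff_partialY ih
  induction i with
  | zero => exact hj
  | succ i ih => rw [Function.iterate_succ_apply']; exact contDiff_partialX ih

theorem partialY_partialX {f : 𝕜 × 𝕜 → 𝕜} (hf : ContDiff 𝕜 ∞ f) :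
    partialY (partialX f) = partialX (partialY f) := by
  funext p
  have hd : DifferentiableAt 𝕜 (fderiv 𝕜 f) p :=
    ((hf.fderiv_right (m := ∞) le_rfl).differentiable (by simp)) p
  have hs : IsSymmSndFDerivAt 𝕜 f p :=
    hf.contDiffAt.isSymmSndFDerivAt (by
      rw [minSmoothness_of_isRCLikeNormedField]
      exact WithTop.coe_le_coe.mpr le_top)
  have key : ∀ v w : 𝕜 × 𝕜, fderiv 𝕜 (fun x => fderiv 𝕜 f x v) p w =
      fderiv 𝕜 (fderiv 𝕜 f) p w v := by
    intro v w
    rw [fderiv_clm_apply hd (differentiableAt_const v)]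
    simp
  change fderiv 𝕜 (fun x => fderiv 𝕜 f x (1, 0)) p (0, 1) =
    fderiv 𝕜 (fun x => fderiv 𝕜 f x (0, 1)) p (1, 0)
  rw [key, key]
  exact hs _ _

theorem partialY_iterate_partialX {f : 𝕜 × 𝕜 → 𝕜} (hf : ContDiff 𝕜 ∞ f) (i j : ℕ) :
    partialY (partialX^[i] (partialY^[j] f)) = partialX^[i] (partialY^[j + 1] f) := by
  induction i with
  | zero => simp only [Function.iterate_zero, id, Function.iterate_succ_apply']
  | succ i ih =>
    rw [Function.iterate_succ_apply', partialY_partialX (contDiff_iterate_partial hf i j), ih,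
      Function.iterate_succ_apply' (f := partialX)]

/-- The constant coefficient differential operator with symbol `q`, applied to `f`. -/
def diffOp (f : 𝕜 × 𝕜 → 𝕜) (q : MvPolynomial (Fin 2) 𝕜) : 𝕜 × 𝕜 → 𝕜 :=
  fun p => pairing (fun i j => (partialX^[i] (partialY^[j] f)) p) q

theorem diffOp_monomial (f : 𝕜 × 𝕜 → 𝕜) (m : Fin 2 →₀ ℕ) (r : 𝕜) :
    diffOp f (monomial m r) = fun p => r * (partialX^[m 0] (partialY^[m 1] f)) p := by
  funext p
  exact pairing_monomial _ _ _

theorem diffOp_add (f : 𝕜 × 𝕜 → 𝕜) (q q' : MvPolynomial (Fin 2) 𝕜) :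
    diffOp f (q + q') = fun p => diffOp f q p + diffOp f q' p := by
  funext p
  exact map_add _ _ _

theorem diffOp_one (f : 𝕜 × 𝕜 → 𝕜) : diffOp f 1 = f := by
  rw [← C_1, C_apply, diffOp_monomial]
  simp

theorem contDiff_diffOp {f : 𝕜 × 𝕜 → 𝕜} (hf : ContDiff 𝕜 ∞ f) (q : MvPolynomial (Fin 2) 𝕜) :
    ContDiff 𝕜 ∞ (diffOp f q) := by
  induction q using MvPolynomial.induction_on' with
  | monomial m r =>
    rw [diffOp_monomial]
    exact contDiff_const.mul (contDiff_iterate_partial hf _ _)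
  | add p q hp hq =>
    rw [diffOp_add]
    exact hp.add hq

theorem partialX_diffOp {f : 𝕜 × 𝕜 → 𝕜} (hf : ContDiff 𝕜 ∞ f) (q : MvPolynomial (Fin 2) 𝕜) :
    partialX (diffOp f q) = diffOp f (X 0 * q) := by
  induction q using MvPolynomial.induction_on' with
  | monomial m r =>
    have hX : (X 0 * monomial m r : MvPolynomial (Fin 2) 𝕜) =
        monomial (Finsupp.single 0 1 + m) r := by
      rw [X, monomial_mul, one_mul]
    rw [hX, diffOp_monomial, diffOp_monomial]
    funext p
    have hd := ((contDiff_iterate_partial hf (m 0) (m 1)).differentiable (by simp)) p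
    have h0 : (Finsupp.single (0 : Fin 2) 1 + m : Fin 2 →₀ ℕ) 0 = m 0 + 1 := by simp [add_comm]
    have h1 : (Finsupp.single (0 : Fin 2) 1 + m : Fin 2 →₀ ℕ) 1 = m 1 := by simp
    rw [h0, h1, Function.iterate_succ_apply', partialX, fderiv_const_mul hd]
    rfl
  | add p q hp hq =>
    rw [mul_add, diffOp_add, diffOp_add, ← hp, ← hq]
    funext x
    rw [partialX, fderiv_fun_add ((contDiff_diffOp hf p).differentiable (by simp) x)
      ((contDiff_diffOp hf q).differentiable (by simp) x)]
    rfl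

theorem partialY_diffOp {f : 𝕜 × 𝕜 → 𝕜} (hf : ContDiff 𝕜 ∞ f) (q : MvPolynomial (Fin 2) 𝕜) :
    partialY (diffOp f q) = diffOp f (X 1 * q) := by
  induction q using MvPolynomial.induction_on' with
  | monomial m r =>
    have hX : (X 1 * monomial m r : MvPolynomial (Fin 2) 𝕜) =
        monomial (Finsupp.single 1 1 + m) r := by
      rw [X, monomial_mul, one_mul]
    rw [hX, diffOp_monomial, diffOp_monomial]
    funext p
    have hd := ((contDiff_iterate_partial hf (m 0) (m 1)).differentiable (by simp)) p
    have h0 : (Finsupp.single (1 : Fin 2) 1 + m : Fin 2 →₀ ℕ) 0 = m 0 := by simp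
    have h1 : (Finsupp.single (1 : Fin 2) 1 + m : Fin 2 →₀ ℕ) 1 = m 1 + 1 := by simp [add_comm]
    rw [h0, h1, ← partialY_iterate_partialX hf, partialY, fderiv_const_mul hd]
    rfl
  | add p q hp hq =>
    rw [mul_add, diffOp_add, diffOp_add, ← hp, ← hq]
    funext x
    rw [partialY, fderiv_fun_add ((contDiff_diffOp hf p).differentiable (by simp) x)
      ((contDiff_diffOp hf q).differentiable (by simp) x)]
    rfl

theorem hasFDerivAt_affineEquiv (B : (𝕜 × 𝕜) ≃ᵃ[𝕜] (𝕜 × 𝕜)) (p : 𝕜 × 𝕜) :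
    HasFDerivAt B (LinearMap.toContinuousLinearMap (B.linear : 𝕜 × 𝕜 →ₗ[𝕜] 𝕜 × 𝕜)) p := by
  have h : (B : 𝕜 × 𝕜 → 𝕜 × 𝕜) = fun q =>
      LinearMap.toContinuousLinearMap (B.linear : 𝕜 × 𝕜 →ₗ[𝕜] 𝕜 × 𝕜) q + B 0 := by
    funext q
    have := B.map_vadd 0 q
    simpa using this
  rw [h]
  exact (ContinuousLinearMap.hasFDerivAt _).add_const _

theorem fderiv_comp_affineEquiv (B : (𝕜 × 𝕜) ≃ᵃ[𝕜] (𝕜 × 𝕜)) {g : 𝕜 × 𝕜 → 𝕜}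
    (hg : ContDiff 𝕜 ∞ g) (p v : 𝕜 × 𝕜) :
    fderiv 𝕜 (g ∘ B) p v =
      (B.linear v).1 * partialX g (B p) + (B.linear v).2 * partialY g (B p) := by
  have hd := (hg.differentiable (by simp) (B p)).hasFDerivAt
  rw [(hd.comp p (hasFDerivAt_affineEquiv B p)).fderiv]
  have hv : B.linear v = (B.linear v).1 • ((1, 0) : 𝕜 × 𝕜) + (B.linear v).2 • ((0, 1) : 𝕜 × 𝕜) := by
    ext <;> simp
  change fderiv 𝕜 g (B p) (B.linear v) = _
  conv_lhs => rw [hv]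
  rw [map_add, map_smul, map_smul]
  rfl

theorem partialX_diffOp_comp (B : (𝕜 × 𝕜) ≃ᵃ[𝕜] (𝕜 × 𝕜)) {f : 𝕜 × 𝕜 → 𝕜}
    (hf : ContDiff 𝕜 ∞ f) (q : MvPolynomial (Fin 2) 𝕜) :
    partialX (diffOp f q ∘ B) =
      diffOp f ((C (B.linear (1, 0)).1 * X 0 + C (B.linear (1, 0)).2 * X 1) * q) ∘ B := by
  funext p
  rw [partialX, fderiv_comp_affineEquiv B (contDiff_diffOp hf q), partialX_diffOp hf,
    partialY_diffOp hf]
  simp only [diffOp, Function.comp, add_mul, mul_assoc, map_add]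
  simp only [← smul_eq_C_mul, map_smul, smul_eq_mul]

theorem partialY_diffOp_comp (B : (𝕜 × 𝕜) ≃ᵃ[𝕜] (𝕜 × 𝕜)) {f : 𝕜 × 𝕜 → 𝕜}
    (hf : ContDiff 𝕜 ∞ f) (q : MvPolynomial (Fin 2) 𝕜) :
    partialY (diffOp f q ∘ B) =
      diffOp f ((C (B.linear (0, 1)).1 * X 0 + C (B.linear (0, 1)).2 * X 1) * q) ∘ B := by
  funext p
  rw [partialY, fderiv_comp_affineEquiv B (contDiff_diffOp hf q), partialX_diffOp hf,
    partialY_diffOp hf]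
  simp only [diffOp, Function.comp, add_mul, mul_assoc, map_add]
  simp only [← smul_eq_C_mul, map_smul, smul_eq_mul]

end JetCalculus

/-! ### The prolonged action in coordinates -/

section Prolong

variable {R S : Type*} [CommRing R] [CommRing S]

/-- The prolonged affine action in coordinates: the jet with base point `(s, t)` whose Taylor
coefficients are those of `z`, moved by the matrix `(a, b; c, d)`. -/
def prolong (s t a b c d : R) (z : JetVar → R) : JetVar → R
  | .x => s
  | .y => t
  | .u i j => moved a b c d (fun i j => z (.u i j)) i j

theorem map_prolong (φ : R →+* S) (s t a b c d : R) (z : JetVar → R) (v : JetVar) :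
    φ (prolong s t a b c d z v) =
      prolong (φ s) (φ t) (φ a) (φ b) (φ c) (φ d) (fun v => φ (z v)) v := by
  cases v with
  | x => rfl
  | y => rfl
  | u i j => exact map_moved φ a b c d _ i j

theorem prolong_prolong (s t a b c d s' t' a' b' c' d' : R) (z : JetVar → R) :
    prolong s' t' a' b' c' d' (prolong s t a b c d z) =
      prolong s' t' (a' * a + b' * c) (a' * b + b' * d) (c' * a + d' * c) (c' * b + d' * d) z := by
  funext v
  cases v with
  | x => rfl
  | y => rfl
  | u i j => exact congrFun (congrFun (moved_moved a b c d a' b' c' d' fun i j => z (.u i j)) i) j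

theorem prolong_one (z : JetVar → R) : prolong (z .x) (z .y) 1 0 0 1 z = z := by
  funext v
  cases v with
  | x => rfl
  | y => rfl
  | u i j => exact congrFun (congrFun (moved_one fun i j => z (.u i j)) i) j

end Prolong

/-! ### Transformation and realization of jets -/

section Jets

variable {𝕜 : Type*} [RCLike 𝕜]

/-- The chain rule for jets: composition with an affine map acts linearly on the derivatives. -/
theorem jet_comp_symm (A : (𝕜 × 𝕜) ≃ᵃ[𝕜] (𝕜 × 𝕜)) {f : 𝕜 × 𝕜 → 𝕜} (hf : ContDiff 𝕜 ∞ f)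
    (p : 𝕜 × 𝕜) :
    jet (f ∘ A.symm) (A p) = prolong (A p).1 (A p).2
      (A.symm.linear (1, 0)).1 (A.symm.linear (1, 0)).2
      (A.symm.linear (0, 1)).1 (A.symm.linear (0, 1)).2 (jet f p) := by
  funext v
  cases v with
  | x => rfl
  | y => rfl
  | u i j =>
    have hy : partialY^[j] (f ∘ A.symm) = diffOp f
        ((C (A.symm.linear (0, 1)).1 * X 0 + C (A.symm.linear (0, 1)).2 * X 1) ^ j) ∘ A.symm := by
      induction j with
      | zero => rw [pow_zero, diffOp_one]; rfl
      | succ j ih => rw [Function.iterate_succ_apply', ih, partialY_diffOp_comp _ hf, pow_succ']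
    have hx : partialX^[i] (partialY^[j] (f ∘ A.symm)) = diffOp f
        ((C (A.symm.linear (1, 0)).1 * X 0 + C (A.symm.linear (1, 0)).2 * X 1) ^ i *
          (C (A.symm.linear (0, 1)).1 * X 0 + C (A.symm.linear (0, 1)).2 * X 1) ^ j) ∘
            A.symm := by
      induction i with
      | zero => rw [pow_zero, one_mul, ← hy]; rfl
      | succ i ih =>
        rw [Function.iterate_succ_apply', ih, partialX_diffOp_comp _ hf, pow_succ', mul_assoc]
    change (partialX^[i] (partialY^[j] (f ∘ A.symm))) (A p) = _
    rw [hx, Function.comp, A.symm_apply_apply]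
    rfl

/-- The polynomial function with Taylor expansion `q` at the point `(s, t)`. -/
def polyFun (s t : 𝕜) (q : MvPolynomial (Fin 2) 𝕜) : 𝕜 × 𝕜 → 𝕜 :=
  fun p => eval ![p.1 - s, p.2 - t] q

theorem polyFun_C (s t r : 𝕜) : polyFun s t (C r) = fun _ => r := by
  funext p
  simp [polyFun]

theorem polyFun_add (s t : 𝕜) (q r : MvPolynomial (Fin 2) 𝕜) :
    polyFun s t (q + r) = fun p => polyFun s t q p + polyFun s t r p := by
  funext p
  simp [polyFun]

theorem polyFun_mul (s t : 𝕜) (q r : MvPolynomial (Fin 2) 𝕜) :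
    polyFun s t (q * r) = fun p => polyFun s t q p * polyFun s t r p := by
  funext p
  simp [polyFun]

theorem hasFDerivAt_polyFun (s t : 𝕜) (q : MvPolynomial (Fin 2) 𝕜) (p : 𝕜 × 𝕜) :
    HasFDerivAt (polyFun s t q)
      (polyFun s t (pderiv 0 q) p • ContinuousLinearMap.fst 𝕜 𝕜 𝕜 +
        polyFun s t (pderiv 1 q) p • ContinuousLinearMap.snd 𝕜 𝕜 𝕜) p := by
  induction q using MvPolynomial.induction_on with
  | C r =>
    rw [polyFun_C]
    refine (hasFDerivAt_const r p).congr_fderiv ?_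
    ext <;> simp [polyFun]
  | add q r hq hr =>
    rw [polyFun_add]
    refine (hq.fun_add hr).congr_fderiv ?_
    ext <;> simp [polyFun]
  | mul_X q k hq =>
    have hX : HasFDerivAt (polyFun s t (X k))
        (polyFun s t (pderiv 0 (X k)) p • ContinuousLinearMap.fst 𝕜 𝕜 𝕜 +
          polyFun s t (pderiv 1 (X k)) p • ContinuousLinearMap.snd 𝕜 𝕜 𝕜) p := by
      fin_cases k
      · have e : polyFun s t (X 0) = fun p => p.1 - s := by
          funext p
          simp [polyFun]
        change HasFDerivAt (polyFun s t (X 0)) _ p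
        rw [e]
        refine (hasFDerivAt_fst.sub_const s).congr_fderiv ?_
        ext <;> simp [polyFun, pderiv_X]
      · have e : polyFun s t (X 1) = fun p => p.2 - t := by
          funext p
          simp [polyFun]
        change HasFDerivAt (polyFun s t (X 1)) _ p
        rw [e]
        refine (hasFDerivAt_snd.sub_const t).congr_fderiv ?_
        ext <;> simp [polyFun, pderiv_X]
    rw [polyFun_mul]
    refine (hq.mul hX).congr_fderiv ?_
    ext <;> simp [polyFun, Derivation.leibniz]

theorem partialX_polyFun (s t : 𝕜) (q : MvPolynomial (Fin 2) 𝕜) :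
    partialX (polyFun s t q) = polyFun s t (pderiv 0 q) := by
  funext p
  rw [partialX, (hasFDerivAt_polyFun s t q p).fderiv]
  simp

theorem partialY_polyFun (s t : 𝕜) (q : MvPolynomial (Fin 2) 𝕜) :
    partialY (polyFun s t q) = polyFun s t (pderiv 1 q) := by
  funext p
  rw [partialY, (hasFDerivAt_polyFun s t q p).fderiv]
  simp

theorem contDiff_polyFun (s t : 𝕜) (q : MvPolynomial (Fin 2) 𝕜) :
    ContDiff 𝕜 ∞ (polyFun s t q) := by
  induction q using MvPolynomial.induction_on with
  | C r => rw [polyFun_C]; exact contDiff_const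
  | add q r hq hr => rw [polyFun_add]; exact hq.add hr
  | mul_X q k hq =>
    have hk : ContDiff 𝕜 ∞ (polyFun s t (X k)) := by
      have e : polyFun s t (X k) = fun p : 𝕜 × 𝕜 => (![p.1 - s, p.2 - t] : Fin 2 → 𝕜) k := by
        funext p
        simp [polyFun]
      rw [e]
      fin_cases k
      · exact contDiff_fst.sub contDiff_const
      · exact contDiff_snd.sub contDiff_const
    rw [polyFun_mul]
    exact hq.mul hk

theorem coeff_iterate_pderiv (v : Fin 2) (n : ℕ) (m : Fin 2 →₀ ℕ) (q : MvPolynomial (Fin 2) 𝕜) :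
    coeff m ((pderiv v)^[n] q) * ((m v).factorial : 𝕜) =
      coeff (m + Finsupp.single v n) q * ((m v + n).factorial : 𝕜) := by
  induction n generalizing m with
  | zero => simp
  | succ n ih =>
    rw [Function.iterate_succ_apply', coeff_pderiv]
    have h := ih (m + Finsupp.single v 1)
    simp only [Finsupp.add_apply, Finsupp.single_eq_same, Nat.factorial_succ, Nat.cast_mul,
      add_assoc, ← Finsupp.single_add, Nat.cast_add, Nat.cast_one] at h
    rw [add_comm 1 n] at h
    rw [← h]
    ring

theorem jet_polyFun (s t : 𝕜) (q : MvPolynomial (Fin 2) 𝕜) (i j : ℕ) :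
    jet (polyFun s t q) (s, t) (.u i j) =
      coeff (Finsupp.single 0 i + Finsupp.single 1 j) q * (i.factorial * j.factorial) := by
  have hy : partialY^[j] (polyFun s t q) = polyFun s t ((pderiv 1)^[j] q) := by
    induction j with
    | zero => rfl
    | succ j ih => rw [Function.iterate_succ_apply', ih, partialY_polyFun,
        Function.iterate_succ_apply']
  have hx : ∀ r, partialX^[i] (polyFun s t r) = polyFun s t ((pderiv 0)^[i] r) := by
    intro r
    induction i with
    | zero => rfl
    | succ i ih => rw [Function.iterate_succ_apply', ih, partialX_polyFun,
        Function.iterate_succ_apply']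
  have h0 : (![s - s, t - t] : Fin 2 → 𝕜) = 0 := by
    funext k
    fin_cases k <;> simp
  change (partialX^[i] (partialY^[j] (polyFun s t q))) (s, t) = _
  rw [hy, hx, polyFun, h0, eval_zero, constantCoeff_eq]
  have e0 := coeff_iterate_pderiv 0 i 0 ((pderiv 1)^[j] q)
  have e1 := coeff_iterate_pderiv 1 j (Finsupp.single 0 i) q
  simp only [Finsupp.coe_zero, Pi.zero_apply, Nat.factorial_zero, Nat.cast_one, mul_one,
    zero_add] at e0
  simp only [ne_eq, not_false_eq_true, one_ne_zero, Finsupp.single_eq_of_ne,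
    Nat.factorial_zero, Nat.cast_one, mul_one, zero_add] at e1
  rw [e0, e1]
  ring

/-- Any finite set of jet coordinates can be prescribed arbitrarily, by the jet of a polynomial.
(A polynomial serves the real and the complex case alike; in the complex case not every
infinite jet is the jet of a holomorphic function.) -/
theorem exists_jet_eq (z : JetVar → 𝕜) (V : Finset JetVar) :
    ∃ (f : 𝕜 × 𝕜 → 𝕜) (p : 𝕜 × 𝕜), ContDiff 𝕜 ∞ f ∧ ∀ v ∈ V, jet f p v = z v := by
  classical
  have hinj : Function.Injective fun p : ℕ × ℕ => JetVar.u p.1 p.2 := by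
    rintro ⟨i, j⟩ ⟨k, l⟩ h
    simpa using h
  let T : Finset (ℕ × ℕ) := V.preimage _ hinj.injOn
  let q : MvPolynomial (Fin 2) 𝕜 := ∑ e ∈ T,
    monomial (Finsupp.single 0 e.1 + Finsupp.single 1 e.2)
      (z (.u e.1 e.2) / (e.1.factorial * e.2.factorial))
  refine ⟨polyFun (z .x) (z .y) q, (z .x, z .y), contDiff_polyFun _ _ _, fun v hv => ?_⟩
  cases v with
  | x => rfl
  | y => rfl
  | u i j =>
    have hT : (i, j) ∈ T := by simpa [T] using hv
    have hc : coeff (Finsupp.single 0 i + Finsupp.single 1 j) q =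
        z (.u i j) / (i.factorial * j.factorial) := by
      rw [coeff_sum, Finset.sum_eq_single_of_mem (i, j) hT]
      · rw [coeff_monomial, if_pos rfl]
      · rintro ⟨k, l⟩ _ hne
        rw [coeff_monomial, if_neg]
        intro he
        have h0 := DFunLike.congr_fun he 0
        have h1 := DFunLike.congr_fun he 1
        simp at h0 h1
        exact hne (by rw [h0, h1])
    rw [jet_polyFun, hc, div_mul_cancel₀]
    exact mul_ne_zero (by exact_mod_cast i.factorial_ne_zero)
      (by exact_mod_cast j.factorial_ne_zero)

end Jets

/-! ### The coframe and its coefficients -/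

section Coframe

variable (𝕜 : Type*) [Field 𝕜]

/-- The numerator of `I2`. -/
def I2num : JetPoly 𝕜 :=
  X (.u 0 1) ^ 2 * X (.u 2 0) - 2 * X (.u 1 0) * X (.u 0 1) * X (.u 1 1) +
    X (.u 1 0) ^ 2 * X (.u 0 2)

/-- The denominator of `I2`, the Hessian determinant. -/
def I2den : JetPoly 𝕜 := X (.u 2 0) * X (.u 0 2) - X (.u 1 1) ^ 2

/-- The numerator of the derivative of `I2` by the quotient rule. -/
def I2derNum (D : Derivation 𝕜 (JetPoly 𝕜) (JetPoly 𝕜)) : JetPoly 𝕜 :=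
  D (I2num 𝕜) * I2den 𝕜 - I2num 𝕜 * D (I2den 𝕜)

theorem I2den_ne_zero : I2den 𝕜 ≠ 0 := by
  intro h
  have := congrArg (eval fun v => match v with
    | JetVar.u 2 0 => (1 : 𝕜)
    | JetVar.u 0 2 => 1
    | _ => 0) h
  simp [I2den] at this

variable {𝕜} in
theorem algebraMap_ne_zero {P : JetPoly 𝕜} (h : P ≠ 0) :
    algebraMap (JetPoly 𝕜) (JetField 𝕜) P ≠ 0 :=
  (map_ne_zero_iff _ (IsFractionRing.injective _ _)).mpr h

theorem I2_eq_div : I2 𝕜 = algebraMap (JetPoly 𝕜) (JetField 𝕜) (I2num 𝕜) /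
    algebraMap (JetPoly 𝕜) (JetField 𝕜) (I2den 𝕜) := by
  have h2 : algebraMap (JetPoly 𝕜) (JetField 𝕜) 2 = 2 := map_ofNat _ 2
  simp only [I2, I2num, I2den, u, map_sub, map_add, map_mul, map_pow, h2]

theorem extendDer_I2 (D : Derivation 𝕜 (JetPoly 𝕜) (JetPoly 𝕜)) :
    extendDer D (I2 𝕜) = algebraMap (JetPoly 𝕜) (JetField 𝕜) (I2derNum 𝕜 D) /
      algebraMap (JetPoly 𝕜) (JetField 𝕜) (I2den 𝕜) ^ 2 := by
  rw [I2_eq_div, extendDer_div D _ _ (I2den_ne_zero 𝕜), map_pow]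
  rfl

theorem extendDer_u (D : Derivation 𝕜 (JetPoly 𝕜) (JetPoly 𝕜)) (i j : ℕ) :
    extendDer D (u 𝕜 i j) = algebraMap (JetPoly 𝕜) (JetField 𝕜) (D (X (.u i j))) := by
  have h := extendDer_div D (X (.u i j)) 1 one_ne_zero
  rw [map_one, div_one] at h
  rw [u, h]
  simp

@[simp]
theorem polyDx_X_u (i j : ℕ) : polyDx 𝕜 (X (.u i j)) = X (.u (i + 1) j) := by
  simp [polyDx, mkDerivation_X]

@[simp]
theorem polyDy_X_u (i j : ℕ) : polyDy 𝕜 (X (.u i j)) = X (.u i (j + 1)) := by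
  simp [polyDy, mkDerivation_X]

theorem omega1_eq : omega1 𝕜 = C (u 𝕜 1 0) * X 0 + C (u 𝕜 0 1) * X 1 := by
  rw [omega1, totalDiff, extendDer_u, extendDer_u, polyDx_X_u, polyDy_X_u]
  rfl

/-- The determinant of the coframe `ω₁, ω₂` in the basis `dx, dy`. -/
def coframeDet : JetField 𝕜 :=
  u 𝕜 1 0 * extendDer (polyDy 𝕜) (I2 𝕜) - u 𝕜 0 1 * extendDer (polyDx 𝕜) (I2 𝕜)

theorem coframeDet_ne_zero : coframeDet 𝕜 ≠ 0 := by
  have hW : (X (.u 1 0) * I2derNum 𝕜 (polyDy 𝕜) - X (.u 0 1) * I2derNum 𝕜 (polyDx 𝕜) :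
      JetPoly 𝕜) ≠ 0 := by
    intro h
    -- At a jet with `u₁₀ = u₂₀ = u₀₂ = u₂₁ = 1` and all other coordinates zero, the
    -- determinant is `-1`.
    have := congrArg (eval fun v => match v with
      | JetVar.u 1 0 => (1 : 𝕜)
      | JetVar.u 2 0 => 1
      | JetVar.u 0 2 => 1
      | JetVar.u 2 1 => 1
      | _ => 0) h
    simp [I2derNum, I2num, I2den, Derivation.leibniz, Derivation.leibniz_pow] at this
  have h := algebraMap_ne_zero hW
  have hd := algebraMap_ne_zero (I2den_ne_zero 𝕜)
  rw [coframeDet, extendDer_I2, extendDer_I2, ← mul_div_assoc, ← mul_div_assoc, ← sub_div]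
  refine div_ne_zero ?_ (pow_ne_zero 2 hd)
  simpa [u] using h

theorem X_zero_eq_coframe : (X 0 : HForm 𝕜) =
    C (extendDer (polyDy 𝕜) (I2 𝕜) / coframeDet 𝕜) * omega1 𝕜 +
      C (-u 𝕜 0 1 / coframeDet 𝕜) * omega2 𝕜 := by
  have h : extendDer (polyDy 𝕜) (I2 𝕜) / coframeDet 𝕜 * u 𝕜 1 0 +
      -u 𝕜 0 1 / coframeDet 𝕜 * extendDer (polyDx 𝕜) (I2 𝕜) = 1 := by
    rw [div_mul_eq_mul_div, div_mul_eq_mul_div, ← add_div,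
      div_eq_one_iff_eq (coframeDet_ne_zero 𝕜), coframeDet]
    ring
  have h' : extendDer (polyDy 𝕜) (I2 𝕜) / coframeDet 𝕜 * u 𝕜 0 1 +
      -u 𝕜 0 1 / coframeDet 𝕜 * extendDer (polyDy 𝕜) (I2 𝕜) = 0 := by ring
  have hC := congrArg (C : JetField 𝕜 → HForm 𝕜) h
  have hC' := congrArg (C : JetField 𝕜 → HForm 𝕜) h'
  rw [C_add, C_mul, C_mul] at hC hC'
  rw [C_1] at hC
  rw [C_0] at hC'
  rw [omega1_eq, omega2, totalDiff]
  linear_combination -(X 0 : HForm 𝕜) * hC - (X 1 : HForm 𝕜) * hC'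

theorem X_one_eq_coframe : (X 1 : HForm 𝕜) =
    C (-extendDer (polyDx 𝕜) (I2 𝕜) / coframeDet 𝕜) * omega1 𝕜 +
      C (u 𝕜 1 0 / coframeDet 𝕜) * omega2 𝕜 := by
  have h : -extendDer (polyDx 𝕜) (I2 𝕜) / coframeDet 𝕜 * u 𝕜 0 1 +
      u 𝕜 1 0 / coframeDet 𝕜 * extendDer (polyDy 𝕜) (I2 𝕜) = 1 := by
    rw [div_mul_eq_mul_div, div_mul_eq_mul_div, ← add_div,
      div_eq_one_iff_eq (coframeDet_ne_zero 𝕜), coframeDet]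
    ring
  have h' : -extendDer (polyDx 𝕜) (I2 𝕜) / coframeDet 𝕜 * u 𝕜 1 0 +
      u 𝕜 1 0 / coframeDet 𝕜 * extendDer (polyDx 𝕜) (I2 𝕜) = 0 := by ring
  have hC := congrArg (C : JetField 𝕜 → HForm 𝕜) h
  have hC' := congrArg (C : JetField 𝕜 → HForm 𝕜) h'
  rw [C_add, C_mul, C_mul] at hC hC'
  rw [C_1] at hC
  rw [C_0] at hC'
  rw [omega1_eq, omega2, totalDiff]
  linear_combination -(X 1 : HForm 𝕜) * hC - (X 0 : HForm 𝕜) * hC'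

theorem coframe_linearIndependent : LinearIndependent (JetField 𝕜) ![omega1 𝕜, omega2 𝕜] := by
  rw [LinearIndependent.pair_iff]
  intro r s h
  rw [smul_eq_C_mul, smul_eq_C_mul, omega1_eq, omega2, totalDiff] at h
  have e : C (r * u 𝕜 1 0 + s * extendDer (polyDx 𝕜) (I2 𝕜)) * X 0 +
      C (r * u 𝕜 0 1 + s * extendDer (polyDy 𝕜) (I2 𝕜)) * X 1 = (0 : HForm 𝕜) := by
    rw [← h]
    simp only [map_add, map_mul]
    ring
  have h0 := congrArg (eval ![1, 0]) e
  have h1 := congrArg (eval ![0, 1]) e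
  simp at h0 h1
  have hD := coframeDet_ne_zero 𝕜
  constructor
  · refine (mul_eq_zero.mp ?_).resolve_right hD
    rw [coframeDet]
    linear_combination extendDer (polyDy 𝕜) (I2 𝕜) * h0 - extendDer (polyDx 𝕜) (I2 𝕜) * h1
  · refine (mul_eq_zero.mp ?_).resolve_right hD
    rw [coframeDet]
    linear_combination u 𝕜 1 0 * h1 - u 𝕜 0 1 * h0

/-- The coefficients of the forms `Θ_k` in the coframe `ω₁, ω₂`: the Taylor coefficients moved by
the inverse of the coframe matrix. -/
def tresseCoeff (i j : ℕ) : JetField 𝕜 :=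
  moved (extendDer (polyDy 𝕜) (I2 𝕜) / coframeDet 𝕜)
    (-extendDer (polyDx 𝕜) (I2 𝕜) / coframeDet 𝕜)
    (-u 𝕜 0 1 / coframeDet 𝕜) (u 𝕜 1 0 / coframeDet 𝕜) (u 𝕜) i j

variable [CharZero 𝕜]

instance : CharZero (JetField 𝕜) :=
  charZero_of_injective_algebraMap (algebraMap 𝕜 (JetField 𝕜)).injective

theorem areTresseCoeffs_tresseCoeff : AreTresseCoeffs (tresseCoeff 𝕜) := fun k =>
  taylor_change_of_frame (u 𝕜) _ _ _ _ (X_zero_eq_coframe 𝕜) (X_one_eq_coframe 𝕜) k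

variable {𝕜} in
theorem AreTresseCoeffs.eq_tresseCoeff {I : ℕ → ℕ → JetField 𝕜} (h : AreTresseCoeffs I) :
    I = tresseCoeff 𝕜 := by
  refine taylor_coeff_unique (X_zero_eq_coframe 𝕜) (X_one_eq_coframe 𝕜) ?_ fun k =>
    (h k).symm.trans (areTresseCoeffs_tresseCoeff 𝕜 k)
  have hD := coframeDet_ne_zero 𝕜
  have e : extendDer (polyDy 𝕜) (I2 𝕜) / coframeDet 𝕜 * (u 𝕜 1 0 / coframeDet 𝕜) -
      -u 𝕜 0 1 / coframeDet 𝕜 * (-extendDer (polyDx 𝕜) (I2 𝕜) / coframeDet 𝕜) =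
      (coframeDet 𝕜)⁻¹ := by
    rw [div_mul_div_comm, div_mul_div_comm, ← sub_div, inv_eq_one_div,
      div_eq_div_iff (mul_ne_zero hD hD) hD]
    rw [coframeDet]
    ring
  rw [e]
  exact inv_ne_zero hD

end Coframe

/-! ### Pull-back by prolonged affine maps -/

section Invariance

variable {𝕜 : Type*} [Field 𝕜]

/-- The matrices `(α, β; γ, δ)` and `(a, c; b, d)` are inverse to each other. -/
structure InverseMatrices (α β γ δ a b c d : 𝕜) : Prop where
  fwd_xx : α * a + β * b = 1
  fwd_xy : α * c + β * d = 0
  fwd_yx : γ * a + δ * b = 0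
  fwd_yy : γ * c + δ * d = 1
  bwd_xx : a * α + c * γ = 1
  bwd_xy : a * β + c * δ = 0
  bwd_yx : b * α + d * γ = 0
  bwd_yy : b * β + d * δ = 1

/-- The pull-back of polynomial functions on jets by the prolonged affine map
`(x, y) ↦ (α x + β y + e, γ x + δ y + f)`, where `(a, c; b, d)` is the inverse of
`(α, β; γ, δ)`. -/
def jetPullback (α β γ δ e f a b c d : 𝕜) : JetPoly 𝕜 →ₐ[𝕜] JetPoly 𝕜 :=
  aeval (prolong (C α * X .x + C β * X .y + C e) (C γ * X .x + C δ * X .y + C f)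
    (C a) (C b) (C c) (C d) X)

variable {α β γ δ a b c d : 𝕜}

theorem jetPullback_X_u (e f : 𝕜) (i j : ℕ) :
    jetPullback α β γ δ e f a b c d (X (.u i j)) =
      moved (C a) (C b) (C c) (C d) (fun i j => X (.u i j)) i j := by
  rw [jetPullback, aeval_X]
  rfl

theorem jetPullback_injective (h : InverseMatrices α β γ δ a b c d) (e f : 𝕜) :
    Function.Injective (jetPullback α β γ δ e f a b c d) := by
  -- The pull-back by the inverse affine map is a left inverse.
  have hinv : (jetPullback a c b d (-(a * e + c * f)) (-(b * e + d * f)) α γ β δ).comp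
      (jetPullback α β γ δ e f a b c d) = AlgHom.id 𝕜 _ := by
    refine MvPolynomial.algHom_ext fun v => ?_
    rw [AlgHom.comp_apply, AlgHom.id_apply]
    have C1 := fun r s t v w : 𝕜 => congrArg (C : 𝕜 → JetPoly 𝕜) (a₁ := r * s + t * v) (a₂ := w)
    simp only [C_add, C_mul] at C1
    have e1 := C1 _ _ _ _ _ h.fwd_xx
    have e2 := C1 _ _ _ _ _ h.fwd_xy
    have e3 := C1 _ _ _ _ _ h.fwd_yx
    have e4 := C1 _ _ _ _ _ h.fwd_yy
    rw [C_0] at e2 e3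
    rw [C_1] at e1 e4
    cases v with
    | x =>
      simp only [jetPullback, aeval_X, prolong, map_add, map_mul, algHom_C, algebraMap_eq,
        map_neg]
      linear_combination (X .x - C e) * e1 + (X .y - C f) * e2
    | y =>
      simp only [jetPullback, aeval_X, prolong, map_add, map_mul, algHom_C, algebraMap_eq,
        map_neg]
      linear_combination (X .x - C e) * e3 + (X .y - C f) * e4
    | u i j =>
      have hm := map_moved (jetPullback a c b d (-(a * e + c * f)) (-(b * e + d * f)) α γ β δ :
        JetPoly 𝕜 →+* JetPoly 𝕜) (C a) (C b) (C c) (C d) (fun i j => X (.u i j)) i j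
      rw [jetPullback_X_u]
      refine hm.trans ?_
      simp only [RingHom.coe_coe, algHom_C, algebraMap_eq, jetPullback_X_u]
      have hmm := moved_moved (C α) (C γ) (C β) (C δ) (C a) (C b) (C c) (C d)
        (fun i j => (X (.u i j) : JetPoly 𝕜))
      refine (congrFun (congrFun hmm i) j).trans ?_
      rw [mul_comm (C a), mul_comm (C b), mul_comm (C a), mul_comm (C b), mul_comm (C c),
        mul_comm (C d), mul_comm (C c), mul_comm (C d), e1, e2, e3, e4, moved_one]
  intro P Q hPQ
  have := congrArg (jetPullback a c b d (-(a * e + c * f)) (-(b * e + d * f)) α γ β δ) hPQ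
  rwa [← AlgHom.comp_apply, ← AlgHom.comp_apply, hinv] at this

end Invariance

/-! ### Explicit low-order formulas for the action -/

section Moved

variable {R : Type*} [CommRing R]

theorem pairing_C_mul (z : ℕ → ℕ → R) (r : R) (q : MvPolynomial (Fin 2) R) :
    pairing z (C r * q) = r * pairing z q := by
  rw [← smul_eq_C_mul, map_smul, smul_eq_mul]

theorem moved_succ_add (p q : R) (a b c d : R) (z : ℕ → ℕ → R) (i j : ℕ) :
    p * moved a b c d z (i + 1) j + q * moved a b c d z i (j + 1) =
      pairing z ((C (p * a + q * c) * X 0 + C (p * b + q * d) * X 1) *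
        ((C a * X 0 + C b * X 1) ^ i * (C c * X 0 + C d * X 1) ^ j)) := by
  rw [moved, moved, ← pairing_C_mul, ← pairing_C_mul, ← map_add]
  congr 1
  simp only [map_add, map_mul]
  ring

theorem moved_one_zero (a b c d : R) (z : ℕ → ℕ → R) :
    moved a b c d z 1 0 = a * z 1 0 + b * z 0 1 := by
  have e : (C a * X 0 + C b * X 1 : MvPolynomial (Fin 2) R) ^ 1 *
      (C c * X 0 + C d * X 1) ^ 0 = a • (X 0 ^ 1 * X 1 ^ 0) + b • (X 0 ^ 0 * X 1 ^ 1) := by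
    simp only [smul_eq_C_mul]
    ring
  rw [moved, e]
  simp only [map_add, map_smul, pairing_X_pow, smul_eq_mul]

theorem moved_zero_one (a b c d : R) (z : ℕ → ℕ → R) :
    moved a b c d z 0 1 = c * z 1 0 + d * z 0 1 := by
  have e : (C a * X 0 + C b * X 1 : MvPolynomial (Fin 2) R) ^ 0 *
      (C c * X 0 + C d * X 1) ^ 1 = c • (X 0 ^ 1 * X 1 ^ 0) + d • (X 0 ^ 0 * X 1 ^ 1) := by
    simp only [smul_eq_C_mul]
    ring
  rw [moved, e]
  simp only [map_add, map_smul, pairing_X_pow, smul_eq_mul]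

theorem moved_two_zero (a b c d : R) (z : ℕ → ℕ → R) :
    moved a b c d z 2 0 = a ^ 2 * z 2 0 + 2 * (a * b) * z 1 1 + b ^ 2 * z 0 2 := by
  have e : (C a * X 0 + C b * X 1 : MvPolynomial (Fin 2) R) ^ 2 *
      (C c * X 0 + C d * X 1) ^ 0 = (a ^ 2) • (X 0 ^ 2 * X 1 ^ 0) +
        (a * b + a * b) • (X 0 ^ 1 * X 1 ^ 1) + (b ^ 2) • (X 0 ^ 0 * X 1 ^ 2) := by
    simp only [smul_eq_C_mul, C_add, C_mul, C_pow]
    ring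
  rw [moved, e]
  simp only [map_add, map_smul, pairing_X_pow, smul_eq_mul]
  ring

theorem moved_one_one (a b c d : R) (z : ℕ → ℕ → R) :
    moved a b c d z 1 1 = a * c * z 2 0 + (a * d + b * c) * z 1 1 + b * d * z 0 2 := by
  have e : (C a * X 0 + C b * X 1 : MvPolynomial (Fin 2) R) ^ 1 *
      (C c * X 0 + C d * X 1) ^ 1 = (a * c) • (X 0 ^ 2 * X 1 ^ 0) +
        (a * d + b * c) • (X 0 ^ 1 * X 1 ^ 1) + (b * d) • (X 0 ^ 0 * X 1 ^ 2) := by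
    simp only [smul_eq_C_mul, C_add, C_mul]
    ring
  rw [moved, e]
  simp only [map_add, map_smul, pairing_X_pow, smul_eq_mul]

theorem moved_zero_two (a b c d : R) (z : ℕ → ℕ → R) :
    moved a b c d z 0 2 = c ^ 2 * z 2 0 + 2 * (c * d) * z 1 1 + d ^ 2 * z 0 2 := by
  have e : (C a * X 0 + C b * X 1 : MvPolynomial (Fin 2) R) ^ 0 *
      (C c * X 0 + C d * X 1) ^ 2 = (c ^ 2) • (X 0 ^ 2 * X 1 ^ 0) +
        (c * d + c * d) • (X 0 ^ 1 * X 1 ^ 1) + (d ^ 2) • (X 0 ^ 0 * X 1 ^ 2) := by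
    simp only [smul_eq_C_mul, C_add, C_mul, C_pow]
    ring
  rw [moved, e]
  simp only [map_add, map_smul, pairing_X_pow, smul_eq_mul]
  ring

end Moved

/-! ### Total derivatives and invariance of the coefficients -/

section TotalDerivatives

variable {𝕜 : Type*} [Field 𝕜] {α β γ δ a b c d : 𝕜}

theorem derivation_C_mul (D : Derivation 𝕜 (JetPoly 𝕜) (JetPoly 𝕜)) (r : 𝕜) (P : JetPoly 𝕜) :
    D (C r * P) = C r * D P := by
  simp [Derivation.leibniz]

theorem polyDx_pairing (q : MvPolynomial (Fin 2) 𝕜) :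
    polyDx 𝕜 (pairing (fun i j => X (.u i j)) (map C q)) =
      pairing (fun i j => X (.u i j)) (X 0 * map C q) := by
  induction q using MvPolynomial.induction_on' with
  | monomial m r =>
    rw [monomial_eq_C_mul_X_pow, smul_eq_C_mul]
    simp only [map_mul, map_C, map_pow, map_X]
    have e : (X 0 : MvPolynomial (Fin 2) (JetPoly 𝕜)) * (C (C r) * (X 0 ^ m 0 * X 1 ^ m 1)) =
        C (C r) * (X 0 ^ (m 0 + 1) * X 1 ^ m 1) := by ring
    rw [e, pairing_C_mul, pairing_C_mul, pairing_X_pow, pairing_X_pow, derivation_C_mul,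
      polyDx_X_u]
  | add p q hp hq => simp only [map_add, mul_add, hp, hq]

theorem polyDy_pairing (q : MvPolynomial (Fin 2) 𝕜) :
    polyDy 𝕜 (pairing (fun i j => X (.u i j)) (map C q)) =
      pairing (fun i j => X (.u i j)) (X 1 * map C q) := by
  induction q using MvPolynomial.induction_on' with
  | monomial m r =>
    rw [monomial_eq_C_mul_X_pow, smul_eq_C_mul]
    simp only [map_mul, map_C, map_pow, map_X]
    have e : (X 1 : MvPolynomial (Fin 2) (JetPoly 𝕜)) * (C (C r) * (X 0 ^ m 0 * X 1 ^ m 1)) =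
        C (C r) * (X 0 ^ m 0 * X 1 ^ (m 1 + 1)) := by ring
    rw [e, pairing_C_mul, pairing_C_mul, pairing_X_pow, pairing_X_pow, derivation_C_mul,
      polyDy_X_u]
  | add p q hp hq => simp only [map_add, mul_add, hp, hq]

theorem moved_C_eq_pairing_map (i j : ℕ) :
    moved (C a) (C b) (C c) (C d) (fun i j => (X (.u i j) : JetPoly 𝕜)) i j =
      pairing (fun i j => X (.u i j))
        (map C ((C a * X 0 + C b * X 1) ^ i * (C c * X 0 + C d * X 1) ^ j)) := by
  simp [moved]

/-- A chain rule relating derivations through a substitution holds as soon as it holds on the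
coordinates. -/
theorem chain_rule_of_coordinates (φ : JetPoly 𝕜 →ₐ[𝕜] JetPoly 𝕜)
    {D E E' : Derivation 𝕜 (JetPoly 𝕜) (JetPoly 𝕜)} {r s : 𝕜}
    (h : ∀ v, D (φ (X v)) = φ (C r * E (X v) + C s * E' (X v))) (P : JetPoly 𝕜) :
    D (φ P) = φ (C r * E P + C s * E' P) := by
  induction P using MvPolynomial.induction_on with
  | C t => simp [algHom_C]
  | add P Q hP hQ =>
    rw [map_add, map_add, hP, hQ, ← map_add]
    congr 1
    simp only [map_add]
    ring
  | mul_X P v hP =>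
    have hv := h v
    simp only [map_mul, map_add, Derivation.leibniz, smul_eq_mul] at hP hv ⊢
    rw [hP, hv]
    ring

/-- The chain rule for the total derivative `d/dx` under an affine change of coordinates. -/
theorem polyDx_jetPullback (h : InverseMatrices α β γ δ a b c d) (e f : 𝕜) (P : JetPoly 𝕜) :
    polyDx 𝕜 (jetPullback α β γ δ e f a b c d P) =
      jetPullback α β γ δ e f a b c d (C α * polyDx 𝕜 P + C γ * polyDy 𝕜 P) := by
  refine chain_rule_of_coordinates _ (fun v => ?_) P
  cases v with
  | x => simp [jetPullback, prolong, polyDx, polyDy, mkDerivation_X, Derivation.leibniz]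
  | y => simp [jetPullback, prolong, polyDx, polyDy, mkDerivation_X, Derivation.leibniz]
  | u i j =>
    simp only [polyDx_X_u, polyDy_X_u, map_add, map_mul, jetPullback_X_u, algHom_C,
      algebraMap_eq]
    rw [moved_succ_add, moved_C_eq_pairing_map, polyDx_pairing, ← C_mul, ← C_mul, ← C_mul,
      ← C_mul, ← C_add, ← C_add, mul_comm α a, mul_comm γ c, mul_comm α b, mul_comm γ d,
      h.bwd_xx, h.bwd_yx]
    simp

/-- The chain rule for the total derivative `d/dy` under an affine change of coordinates. -/
theorem polyDy_jetPullback (h : InverseMatrices α β γ δ a b c d) (e f : 𝕜) (P : JetPoly 𝕜) :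
    polyDy 𝕜 (jetPullback α β γ δ e f a b c d P) =
      jetPullback α β γ δ e f a b c d (C β * polyDx 𝕜 P + C δ * polyDy 𝕜 P) := by
  refine chain_rule_of_coordinates _ (fun v => ?_) P
  cases v with
  | x => simp [jetPullback, prolong, polyDx, polyDy, mkDerivation_X, Derivation.leibniz]
  | y => simp [jetPullback, prolong, polyDx, polyDy, mkDerivation_X, Derivation.leibniz]
  | u i j =>
    simp only [polyDx_X_u, polyDy_X_u, map_add, map_mul, jetPullback_X_u, algHom_C,
      algebraMap_eq]
    rw [moved_succ_add, moved_C_eq_pairing_map, polyDy_pairing, ← C_mul, ← C_mul, ← C_mul,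
      ← C_mul, ← C_add, ← C_add, mul_comm β a, mul_comm δ c, mul_comm β b, mul_comm δ d,
      h.bwd_xy, h.bwd_yy]
    simp

theorem jetPullback_I2num (e f : 𝕜) :
    jetPullback α β γ δ e f a b c d (I2num 𝕜) = C ((a * d - b * c) ^ 2) * I2num 𝕜 := by
  have h2 : jetPullback α β γ δ e f a b c d 2 = 2 := map_ofNat _ 2
  simp only [I2num, map_add, map_sub, map_mul, map_pow, h2, jetPullback_X_u, moved_one_zero,
    moved_zero_one, moved_two_zero, moved_one_one, moved_zero_two]
  ring

theorem jetPullback_I2den (e f : 𝕜) :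
    jetPullback α β γ δ e f a b c d (I2den 𝕜) = C ((a * d - b * c) ^ 2) * I2den 𝕜 := by
  simp only [I2den, map_sub, map_mul, map_pow, jetPullback_X_u, moved_two_zero, moved_one_one,
    moved_zero_two]
  ring

/-- A derivation and a linear combination of derivations that are related by the pull-back give
related derivatives of `I2`, because its numerator and denominator are relative invariants of the
same weight. -/
theorem I2derNum_relation {D E E' : Derivation 𝕜 (JetPoly 𝕜) (JetPoly 𝕜)} {r s e f : 𝕜}
    (hD : ∀ P, D (jetPullback α β γ δ e f a b c d P) =
      jetPullback α β γ δ e f a b c d (C r * E P + C s * E' P)) :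
    C ((a * d - b * c) ^ 2) ^ 2 * I2derNum 𝕜 D = jetPullback α β γ δ e f a b c d
      (C r * I2derNum 𝕜 E + C s * I2derNum 𝕜 E') := by
  have hn := hD (I2num 𝕜)
  have hd := hD (I2den 𝕜)
  rw [jetPullback_I2num, derivation_C_mul] at hn
  rw [jetPullback_I2den, derivation_C_mul] at hd
  simp only [I2derNum, map_add, map_sub, map_mul, jetPullback_I2num, jetPullback_I2den] at hn hd ⊢
  linear_combination C ((a * d - b * c) ^ 2) * I2den 𝕜 * hn -
    C ((a * d - b * c) ^ 2) * I2num 𝕜 * hd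

theorem algebraMap_jetPullback_injective (h : InverseMatrices α β γ δ a b c d) (e f : 𝕜) :
    Function.Injective ((Algebra.algHom 𝕜 (JetPoly 𝕜) (JetField 𝕜)).comp
      (jetPullback α β γ δ e f a b c d)) :=
  fun _ _ hPQ => jetPullback_injective h e f (IsFractionRing.injective (JetPoly 𝕜) _ hPQ)

/-- The pull-back of rational functions on jets by a prolonged affine map. -/
def fieldPullback (h : InverseMatrices α β γ δ a b c d) (e f : 𝕜) : JetField 𝕜 →ₐ[𝕜] JetField 𝕜 :=
  IsFractionRing.liftAlgHom (algebraMap_jetPullback_injective h e f)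

theorem fieldPullback_algebraMap (h : InverseMatrices α β γ δ a b c d) (e f : 𝕜) (P : JetPoly 𝕜) :
    fieldPullback h e f (algebraMap (JetPoly 𝕜) (JetField 𝕜) P) =
      algebraMap (JetPoly 𝕜) (JetField 𝕜) (jetPullback α β γ δ e f a b c d P) :=
  IsFractionRing.lift_algebraMap (algebraMap_jetPullback_injective h e f) P

theorem InverseMatrices.det_mul_det (h : InverseMatrices α β γ δ a b c d) :
    (α * δ - β * γ) * (a * d - b * c) = 1 := by
  linear_combination (γ * c + δ * d) * h.fwd_xx - (γ * a + δ * b) * h.fwd_xy + h.fwd_yy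

theorem extendDer_I2_relation (h : InverseMatrices α β γ δ a b c d)
    {D E E' : Derivation 𝕜 (JetPoly 𝕜) (JetPoly 𝕜)} {r s e f : 𝕜}
    (hD : ∀ P, D (jetPullback α β γ δ e f a b c d P) =
      jetPullback α β γ δ e f a b c d (C r * E P + C s * E' P)) :
    extendDer D (I2 𝕜) = algebraMap 𝕜 (JetField 𝕜) r * fieldPullback h e f (extendDer E (I2 𝕜)) +
      algebraMap 𝕜 (JetField 𝕜) s * fieldPullback h e f (extendDer E' (I2 𝕜)) := by
  have hκ : ((a * d - b * c) ^ 2 : 𝕜) ≠ 0 :=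
    pow_ne_zero 2 (right_ne_zero_of_mul_eq_one h.det_mul_det)
  have hκ' := algebraMap_ne_zero (P := C ((a * d - b * c) ^ 2)) (by rwa [Ne, C_eq_zero])
  have hd := algebraMap_ne_zero (I2den_ne_zero 𝕜)
  have key := congrArg (algebraMap (JetPoly 𝕜) (JetField 𝕜)) (I2derNum_relation hD)
  have hC : ∀ r : 𝕜, algebraMap (JetPoly 𝕜) (JetField 𝕜) (C r) = algebraMap 𝕜 (JetField 𝕜) r :=
    fun r => (IsScalarTower.algebraMap_apply 𝕜 (JetPoly 𝕜) (JetField 𝕜) r).symm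
  rw [hC] at hκ'
  simp only [map_add, map_mul, map_pow, algHom_C, algebraMap_eq, hC] at key hκ'
  simp only [extendDer_I2, map_div₀, map_pow, fieldPullback_algebraMap, jetPullback_I2den,
    map_mul, hC]
  rw [← mul_div_assoc, ← mul_div_assoc, ← add_div,
    div_eq_div_iff (pow_ne_zero 2 hd) (pow_ne_zero 2 (mul_ne_zero hκ' hd))]
  linear_combination algebraMap (JetPoly 𝕜) (JetField 𝕜) (I2den 𝕜) ^ 2 * key

theorem fieldPullback_u (h : InverseMatrices α β γ δ a b c d) (e f : 𝕜) (i j : ℕ) :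
    fieldPullback h e f (u 𝕜 i j) = moved (algebraMap 𝕜 (JetField 𝕜) a)
      (algebraMap 𝕜 (JetField 𝕜) b) (algebraMap 𝕜 (JetField 𝕜) c) (algebraMap 𝕜 (JetField 𝕜) d)
      (u 𝕜) i j := by
  rw [u, fieldPullback_algebraMap, jetPullback_X_u]
  exact map_moved (algebraMap (JetPoly 𝕜) (JetField 𝕜)) _ _ _ _ _ i j

/-- The coefficients in the coframe are invariant: the coframe matrix is multiplied by the same
matrix that acts on the Taylor coefficients. -/
theorem fieldPullback_tresseCoeff (h : InverseMatrices α β γ δ a b c d) (e f : 𝕜) (i j : ℕ) :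
    fieldPullback h e f (tresseCoeff 𝕜 i j) = tresseCoeff 𝕜 i j := by
  have hx := extendDer_I2_relation h (polyDx_jetPullback h e f)
  have hy := extendDer_I2_relation h (polyDy_jetPullback h e f)
  have ux := fieldPullback_u h e f 1 0
  have uy := fieldPullback_u h e f 0 1
  rw [moved_one_zero] at ux
  rw [moved_zero_one] at uy
  have hD0 := coframeDet_ne_zero 𝕜
  have hm := map_moved (fieldPullback h e f : JetField 𝕜 →+* JetField 𝕜)
    (extendDer (polyDy 𝕜) (I2 𝕜) / coframeDet 𝕜) (-extendDer (polyDx 𝕜) (I2 𝕜) / coframeDet 𝕜)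
    (-u 𝕜 0 1 / coframeDet 𝕜) (u 𝕜 1 0 / coframeDet 𝕜) (u 𝕜) i j
  refine hm.trans ?_
  simp only [RingHom.coe_coe, map_div₀, map_neg, fieldPullback_u h e f]
  refine (congrFun (congrFun (moved_moved _ _ _ _ _ _ _ _ _) i) j).trans ?_
  have ha := congrArg (algebraMap 𝕜 (JetField 𝕜)) h.bwd_xx
  have hb := congrArg (algebraMap 𝕜 (JetField 𝕜)) h.bwd_xy
  have hc := congrArg (algebraMap 𝕜 (JetField 𝕜)) h.bwd_yx
  have hd := congrArg (algebraMap 𝕜 (JetField 𝕜)) h.bwd_yy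
  have ux' := fieldPullback_u h e f 1 0
  have uy' := fieldPullback_u h e f 0 1
  have hDdef : fieldPullback h e f (coframeDet 𝕜) =
      fieldPullback h e f (u 𝕜 1 0) * fieldPullback h e f (extendDer (polyDy 𝕜) (I2 𝕜)) -
      fieldPullback h e f (u 𝕜 0 1) * fieldPullback h e f (extendDer (polyDx 𝕜) (I2 𝕜)) := by
    rw [coframeDet, map_sub, map_mul, map_mul]
  have hk := congrArg (algebraMap 𝕜 (JetField 𝕜)) h.det_mul_det
  simp only [map_add, map_sub, map_mul, map_one, map_zero] at hk ha hb hc hd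
  rw [← ux', ← uy', tresseCoeff]
  have hΦ0 : fieldPullback h e f (coframeDet 𝕜) ≠ 0 := (map_ne_zero _).mpr hD0
  rw [ux, uy] at hDdef
  rw [ux, uy]
  have hDx : coframeDet 𝕜 = u 𝕜 1 0 * extendDer (polyDy 𝕜) (I2 𝕜) -
    u 𝕜 0 1 * extendDer (polyDx 𝕜) (I2 𝕜) := rfl
  generalize fieldPullback h e f (extendDer (polyDx 𝕜) (I2 𝕜)) = p at *
  generalize fieldPullback h e f (extendDer (polyDy 𝕜) (I2 𝕜)) = q at *
  generalize fieldPullback h e f (coframeDet 𝕜) = D' at *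
  generalize coframeDet 𝕜 = D at *
  rw [hx, hy] at hDx ⊢
  generalize algebraMap 𝕜 (JetField 𝕜) α = α at *
  generalize algebraMap 𝕜 (JetField 𝕜) β = β at *
  generalize algebraMap 𝕜 (JetField 𝕜) γ = γ at *
  generalize algebraMap 𝕜 (JetField 𝕜) δ = δ at *
  generalize algebraMap 𝕜 (JetField 𝕜) a = a at *
  generalize algebraMap 𝕜 (JetField 𝕜) b = b at *
  generalize algebraMap 𝕜 (JetField 𝕜) c = c at *
  generalize algebraMap 𝕜 (JetField 𝕜) d = d at *
  have e1 : (α * δ - β * γ) * a = δ := by linear_combination δ * ha - γ * hb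
  have e2 : (α * δ - β * γ) * b = -γ := by linear_combination δ * hc - γ * hd
  have e3 : (α * δ - β * γ) * c = -β := by linear_combination α * hb - β * ha
  have e4 : (α * δ - β * γ) * d = α := by linear_combination α * hd - β * hc
  have hDD : D = (α * δ - β * γ) * D' := by
    rw [hDx, hDdef]
    linear_combination -u 𝕜 1 0 * q * e1 - u 𝕜 0 1 * q * e2 + u 𝕜 1 0 * p * e3 +
      u 𝕜 0 1 * p * e4
  have hk0 : α * δ - β * γ ≠ 0 := left_ne_zero_of_mul_eq_one hk
  have entry : ∀ v w r s t : JetField 𝕜, (α * δ - β * γ) * (v * r + w * s) = t →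
      v / D' * r + w / D' * s = t / D := by
    intro v w r s t ht
    rw [hDD, ← ht, mul_div_mul_left _ _ hk0]
    ring
  congr 1
  · exact entry _ _ _ _ _ (by linear_combination q * e1 - p * e3)
  · exact entry _ _ _ _ _ (by linear_combination q * e2 - p * e4)
  · exact entry _ _ _ _ _ (by linear_combination -u 𝕜 0 1 * hk)
  · exact entry _ _ _ _ _ (by linear_combination u 𝕜 1 0 * hk)

end TotalDerivatives

/-! ### Functions of the coefficients are invariant -/

section FixedIsInvariant

variable {𝕜 : Type*} [RCLike 𝕜]

theorem affineEquiv_apply (A : (𝕜 × 𝕜) ≃ᵃ[𝕜] (𝕜 × 𝕜)) (p : 𝕜 × 𝕜) :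
    A p = (p.1 • A.linear (1, 0) + p.2 • A.linear (0, 1)) + A 0 := by
  have h := A.map_vadd 0 p
  have hp : p = p.1 • ((1, 0) : 𝕜 × 𝕜) + p.2 • ((0, 1) : 𝕜 × 𝕜) := by
    ext <;> simp
  have hl := congrArg A.linear hp
  rw [map_add, map_smul, map_smul] at hl
  simp only [vadd_eq_add, add_zero] at h
  rw [h, ← hl]

theorem inverseMatrices_affineEquiv (A : (𝕜 × 𝕜) ≃ᵃ[𝕜] (𝕜 × 𝕜)) :
    InverseMatrices (A.linear (1, 0)).1 (A.linear (0, 1)).1 (A.linear (1, 0)).2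
      (A.linear (0, 1)).2 (A.symm.linear (1, 0)).1 (A.symm.linear (1, 0)).2
      (A.symm.linear (0, 1)).1 (A.symm.linear (0, 1)).2 := by
  have key : ∀ (B : (𝕜 × 𝕜) ≃ᵃ[𝕜] (𝕜 × 𝕜)) (v : 𝕜 × 𝕜),
      (B.symm.linear v).1 • B.linear (1, 0) + (B.symm.linear v).2 • B.linear (0, 1) = v := by
    intro B v
    have hl : B.linear (B.symm.linear v) = v := B.linear.apply_symm_apply v
    have hp : B.symm.linear v = (B.symm.linear v).1 • ((1, 0) : 𝕜 × 𝕜) +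
        (B.symm.linear v).2 • ((0, 1) : 𝕜 × 𝕜) := by
      ext <;> simp
    rw [hp, map_add, map_smul, map_smul] at hl
    exact hl
  have f0 := key A (1, 0)
  have f1 := key A (0, 1)
  have b0 := key A.symm (1, 0)
  have b1 := key A.symm (0, 1)
  change (A.linear (1, 0)).1 • A.symm.linear (1, 0) + (A.linear (1, 0)).2 • A.symm.linear (0, 1) =
    (1, 0) at b0
  change (A.linear (0, 1)).1 • A.symm.linear (1, 0) + (A.linear (0, 1)).2 • A.symm.linear (0, 1) =
    (0, 1) at b1
  simp only [Prod.ext_iff, Prod.fst_add, Prod.snd_add, Prod.smul_fst, Prod.smul_snd,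
    smul_eq_mul] at f0 f1 b0 b1
  constructor <;> first
    | linear_combination f0.1 | linear_combination f0.2 | linear_combination f1.1
    | linear_combination f1.2 | linear_combination b0.1 | linear_combination b0.2
    | linear_combination b1.1 | linear_combination b1.2

/-- The pull-back evaluates at a jet to the value at the transformed jet. -/
theorem eval_jetPullback (A : (𝕜 × 𝕜) ≃ᵃ[𝕜] (𝕜 × 𝕜)) {f : 𝕜 × 𝕜 → 𝕜} (hf : ContDiff 𝕜 ∞ f)
    (p : 𝕜 × 𝕜) (P : JetPoly 𝕜) :
    eval (jet f p) (jetPullback (A.linear (1, 0)).1 (A.linear (0, 1)).1 (A.linear (1, 0)).2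
      (A.linear (0, 1)).2 (A 0).1 (A 0).2 (A.symm.linear (1, 0)).1 (A.symm.linear (1, 0)).2
      (A.symm.linear (0, 1)).1 (A.symm.linear (0, 1)).2 P) =
    eval (jet (f ∘ A.symm) (A p)) P := by
  rw [jet_comp_symm A hf, jetPullback]
  induction P using MvPolynomial.induction_on with
  | C r => simp [algHom_C]
  | add P Q hP hQ => rw [map_add, map_add, map_add, hP, hQ]
  | mul_X P v hP =>
    rw [map_mul, map_mul, map_mul, hP, aeval_X, eval_X, map_prolong]
    congr 1
    have hA := affineEquiv_apply A p
    have hx := congrArg Prod.fst hA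
    have hy := congrArg Prod.snd hA
    simp only [Prod.fst_add, Prod.snd_add, Prod.smul_fst, Prod.smul_snd, smul_eq_mul] at hx hy
    have j1 : jet f p .x = p.1 := rfl
    have j2 : jet f p .y = p.2 := rfl
    simp only [map_add, map_mul, eval_C, eval_X, j1, j2]
    rw [hx, hy, mul_comm p.1, mul_comm p.2, mul_comm p.1, mul_comm p.2]

theorem isAffineInvariant_of_fixed {F : JetField 𝕜}
    (hF : ∀ {α β γ δ a b c d : 𝕜} (h : InverseMatrices α β γ δ a b c d) (e f : 𝕜),
      fieldPullback h e f F = F) : IsAffineInvariant F := by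
  rintro A f hf p c c' ⟨P, Q, hQ, hFP, rfl⟩ ⟨P', Q', hQ', hFP', rfl⟩
  have hfix := hF (inverseMatrices_affineEquiv A) (A 0).1 (A 0).2
  rw [← eval_jetPullback A hf] at hQ'
  rw [← eval_jetPullback A hf, ← eval_jetPullback A hf]
  nth_rw 1 [hFP'] at hfix
  rw [map_div₀, fieldPullback_algebraMap, fieldPullback_algebraMap, hFP] at hfix
  have ne : ∀ {P : JetPoly 𝕜}, eval (jet f p) P ≠ 0 → P ≠ 0 := by
    rintro P h rfl
    simp at h
  rw [div_eq_div_iff (algebraMap_ne_zero (ne hQ')) (algebraMap_ne_zero (ne hQ)), ← map_mul,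
    ← map_mul] at hfix
  have := congrArg (eval (jet f p)) (IsFractionRing.injective (JetPoly 𝕜) (JetField 𝕜) hfix)
  rw [map_mul, map_mul] at this
  rw [div_eq_div_iff hQ' hQ, this]

theorem isAffineInvariant_of_mem_adjoin {F : JetField 𝕜}
    (hF : F ∈ IntermediateField.adjoin 𝕜 (Set.range fun p : ℕ × ℕ => tresseCoeff 𝕜 p.1 p.2)) :
    IsAffineInvariant F := by
  refine isAffineInvariant_of_fixed fun h e f => ?_
  induction hF using IntermediateField.adjoin_induction with
  | mem x hx =>
    obtain ⟨p, rfl⟩ := hx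
    exact fieldPullback_tresseCoeff h e f p.1 p.2
  | algebraMap r => exact (fieldPullback h e f).commutes r
  | add x y _ _ hx hy => rw [map_add, hx, hy]
  | inv x _ hx => rw [map_inv₀, hx]
  | mul x y _ _ hx hy => rw [map_mul, hx, hy]

end FixedIsInvariant

/-! ### Invariants are functions of the coefficients -/

section InvariantIsRational

variable {𝕜 : Type*} [RCLike 𝕜]

/-- The linear automorphism of the plane with `(1, 0) ↦ (a, b)` and `(0, 1) ↦ (c, d)`. -/
def planeLinearEquiv (a b c d : 𝕜) (h : a * d - b * c ≠ 0) : (𝕜 × 𝕜) ≃ₗ[𝕜] (𝕜 × 𝕜) where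
  toFun v := (a * v.1 + c * v.2, b * v.1 + d * v.2)
  map_add' v w := by
    ext <;> simp <;> ring
  map_smul' r v := by
    ext <;> simp <;> ring
  invFun v := ((d * v.1 - c * v.2) / (a * d - b * c), (a * v.2 - b * v.1) / (a * d - b * c))
  left_inv v := by
    ext
    · rw [div_eq_iff h]; ring
    · rw [div_eq_iff h]; ring
  right_inv v := by
    ext
    · dsimp only
      rw [← mul_div_assoc, ← mul_div_assoc, ← add_div, div_eq_iff h]; ring
    · dsimp only
      rw [← mul_div_assoc, ← mul_div_assoc, ← add_div, div_eq_iff h]; ring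

/-- Every nondegenerate prolongation of a jet is the jet of a transformed function. -/
theorem exists_affineEquiv_jet {s t a b c d : 𝕜} (h : a * d - b * c ≠ 0) (p : 𝕜 × 𝕜) :
    ∃ A : (𝕜 × 𝕜) ≃ᵃ[𝕜] (𝕜 × 𝕜), ∀ f, ContDiff 𝕜 ∞ f →
      jet (f ∘ A.symm) (A p) = prolong s t a b c d (jet f p) := by
  let B : (𝕜 × 𝕜) ≃ᵃ[𝕜] (𝕜 × 𝕜) :=
    ((AffineEquiv.constVAdd 𝕜 (𝕜 × 𝕜) (-(s, t))).trans
      (planeLinearEquiv a b c d h).toAffineEquiv).trans (AffineEquiv.constVAdd 𝕜 (𝕜 × 𝕜) p)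
  have hB : B (s, t) = p := by
    simp [B]
  have hl : ∀ v, B.linear v = planeLinearEquiv a b c d h v := fun v => rfl
  refine ⟨B.symm, fun f hf => ?_⟩
  have hp : B.symm p = (s, t) := by rw [B.symm_apply_eq, hB]
  rw [jet_comp_symm B.symm hf, hp]
  change prolong s t (B.linear (1, 0)).1 (B.linear (1, 0)).2 (B.linear (0, 1)).1
    (B.linear (0, 1)).2 (jet f p) = _
  rw [hl, hl]
  simp [planeLinearEquiv]

/-- The generic jet moved by a generic affine map: a substitution into polynomials in the jet
coordinates, the four entries of a matrix and the two coordinates of a base point. -/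
def genericProlong (𝕜 : Type*) [Field 𝕜] : JetVar → MvPolynomial (JetVar ⊕ Fin 6) 𝕜 :=
  prolong (X (.inr 4)) (X (.inr 5)) (X (.inr 0)) (X (.inr 1)) (X (.inr 2)) (X (.inr 3))
    fun v => X (.inl v)

theorem algHom_aeval_genericProlong {K : Type*} [CommRing K] [Algebra 𝕜 K]
    (z : JetVar → K) (g : Fin 6 → K) (P : JetPoly 𝕜) :
    aeval (Sum.elim z g) (aeval (genericProlong 𝕜) P) =
      aeval (prolong (g 4) (g 5) (g 0) (g 1) (g 2) (g 3) z) P := by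
  rw [← AlgHom.comp_apply]
  congr 1
  refine MvPolynomial.algHom_ext fun v => ?_
  rw [AlgHom.comp_apply, aeval_X, aeval_X, genericProlong]
  have := map_prolong (aeval (Sum.elim z g) : MvPolynomial (JetVar ⊕ Fin 6) 𝕜 →ₐ[𝕜] K).toRingHom
    (X (.inr 4)) (X (.inr 5)) (X (.inr 0)) (X (.inr 1)) (X (.inr 2)) (X (.inr 3))
    (fun v => X (.inl v)) v
  simpa using this

theorem aeval_rename_inl {K : Type*} [CommRing K] [Algebra 𝕜 K]
    (z : JetVar → K) (g : Fin 6 → K) (P : JetPoly 𝕜) :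
    aeval (Sum.elim z g) (rename Sum.inl P : MvPolynomial (JetVar ⊕ Fin 6) 𝕜) = aeval z P := by
  rw [aeval_rename, Sum.elim_comp_inl]

/-- Invariance of a fraction as a polynomial identity in the jet coordinates and the coefficients
of the affine map. -/
theorem IsAffineInvariant.generic_identity {P Q : JetPoly 𝕜} (hQ : Q ≠ 0)
    (hF : IsAffineInvariant (algebraMap (JetPoly 𝕜) (JetField 𝕜) P /
      algebraMap (JetPoly 𝕜) (JetField 𝕜) Q)) :
    aeval (genericProlong 𝕜) P * rename Sum.inl Q =
      aeval (genericProlong 𝕜) Q * rename Sum.inl P := by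
  classical
  -- At the identity map with the same base point, the prolonged jet is the original one.
  let g₁ : Fin 6 → JetPoly 𝕜 := ![1, 0, 0, 1, X .x, X .y]
  have hQ1 : (rename Sum.inl Q : MvPolynomial (JetVar ⊕ Fin 6) 𝕜) ≠ 0 :=
    (map_ne_zero_iff _ (rename_injective _ Sum.inl_injective)).mpr hQ
  have hQ2 : aeval (genericProlong 𝕜) Q ≠ 0 := by
    intro h
    have := congrArg (aeval (Sum.elim X g₁)) h
    rw [algHom_aeval_genericProlong, map_zero] at this
    have e : prolong (g₁ 4) (g₁ 5) (g₁ 0) (g₁ 1) (g₁ 2) (g₁ 3) X = X := prolong_one X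
    rw [e, aeval_X_left_apply] at this
    exact hQ this
  let det : MvPolynomial (JetVar ⊕ Fin 6) 𝕜 :=
    X (.inr 0) * X (.inr 3) - X (.inr 1) * X (.inr 2)
  have hdet : det ≠ 0 := by
    intro h
    have := congrArg (aeval (Sum.elim X g₁)) h
    simp [det, g₁] at this
  let E : MvPolynomial (JetVar ⊕ Fin 6) 𝕜 :=
    aeval (genericProlong 𝕜) P * rename Sum.inl Q - aeval (genericProlong 𝕜) Q * rename Sum.inl P
  let T := E * (rename Sum.inl Q * aeval (genericProlong 𝕜) Q * det)
  have hjet : ∀ (f : 𝕜 × 𝕜 → 𝕜) (p : 𝕜 × 𝕜) (g : Fin 6 → 𝕜), ContDiff 𝕜 ∞ f →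
      aeval (Sum.elim (jet f p) g) T = 0 := by
    intro f p g hf
    simp only [T, E, map_mul, map_sub, algHom_aeval_genericProlong, aeval_rename_inl, det, aeval_X,
      Sum.elim_inr]
    by_cases h1 : aeval (jet f p) Q = 0
    · simp [h1]
    by_cases h2 : aeval (prolong (g 4) (g 5) (g 0) (g 1) (g 2) (g 3) (jet f p)) Q = 0
    · simp [h2]
    by_cases h3 : g 0 * g 3 - g 1 * g 2 = 0
    · simp [h3]
    obtain ⟨A, hA⟩ := exists_affineEquiv_jet (s := g 4) (t := g 5) h3 p
    have hval := hF A f hf p _ _ ⟨P, Q, h1, rfl, rfl⟩ ⟨P, Q, by rw [hA f hf]; exact h2, rfl, rfl⟩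
    rw [hA f hf] at hval
    replace hval := (div_eq_div_iff h2 h1).mp hval
    refine mul_eq_zero_of_left (sub_eq_zero.mpr ?_) _
    exact hval.trans (mul_comm _ _)
  have hT : T = 0 := by
    refine MvPolynomial.funext fun w => ?_
    rw [map_zero]
    -- Only finitely many coordinates occur in `T`, so the jet part of `w` may be replaced by
    -- the jet of a polynomial.
    obtain ⟨f, p, hf, hfp⟩ := exists_jet_eq (fun v => w (.inl v))
      (T.vars.preimage Sum.inl Sum.inl_injective.injOn)
    rw [← hjet f p (fun k => w (.inr k)) hf]
    change eval w T = eval _ T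
    refine eval₂Hom_congr' rfl (fun i hi _ => ?_) rfl
    cases i with
    | inl v => exact (hfp v (by simpa using hi)).symm
    | inr k => rfl
  exact sub_eq_zero.mp ((mul_eq_zero.mp hT).resolve_right
    (mul_ne_zero (mul_ne_zero hQ1 hQ2) hdet))

/-- The generic jet moved by the inverse of the coframe, with base point moved to the origin. -/
def framedJet (𝕜 : Type*) [Field 𝕜] : JetVar → JetField 𝕜 :=
  prolong 0 0 (extendDer (polyDy 𝕜) (I2 𝕜) / coframeDet 𝕜)
    (-extendDer (polyDx 𝕜) (I2 𝕜) / coframeDet 𝕜)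
    (-u 𝕜 0 1 / coframeDet 𝕜) (u 𝕜 1 0 / coframeDet 𝕜)
    fun v => algebraMap (JetPoly 𝕜) (JetField 𝕜) (X v)

/-- The coframe matrix moves the framed jet back to the generic jet. -/
theorem prolong_coframe_framedJet :
    prolong (algebraMap (JetPoly 𝕜) (JetField 𝕜) (X .x))
      (algebraMap (JetPoly 𝕜) (JetField 𝕜) (X .y))
      (u 𝕜 1 0) (extendDer (polyDx 𝕜) (I2 𝕜)) (u 𝕜 0 1) (extendDer (polyDy 𝕜) (I2 𝕜))
      (framedJet 𝕜) = fun v => algebraMap (JetPoly 𝕜) (JetField 𝕜) (X v) := by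
  have hD := coframeDet_ne_zero 𝕜
  have e : ∀ p q r s t : JetField 𝕜, p * q + r * s = t * coframeDet 𝕜 →
      p * (q / coframeDet 𝕜) + r * (s / coframeDet 𝕜) = t := by
    intro p q r s t h
    rw [← mul_div_assoc, ← mul_div_assoc, ← add_div, h, mul_div_cancel_right₀ _ hD]
  rw [framedJet, prolong_prolong, e _ _ _ _ 1 (by rw [coframeDet]; ring), e _ _ _ _ 0 (by ring),
    e _ _ _ _ 0 (by ring), e _ _ _ _ 1 (by rw [coframeDet]; ring)]
  exact prolong_one fun v => algebraMap (JetPoly 𝕜) (JetField 𝕜) (X v)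

/-- A polynomial in the jet coordinates, evaluated at the framed jet moved by an affine map with
coefficients in the ground field, is a polynomial in the coefficients `tresseCoeff`. -/
theorem aeval_prolong_framedJet_mem (s t a b c d : 𝕜) (P : JetPoly 𝕜) :
    aeval (prolong (algebraMap 𝕜 (JetField 𝕜) s) (algebraMap 𝕜 (JetField 𝕜) t)
      (algebraMap 𝕜 (JetField 𝕜) a) (algebraMap 𝕜 (JetField 𝕜) b) (algebraMap 𝕜 (JetField 𝕜) c)
      (algebraMap 𝕜 (JetField 𝕜) d) (framedJet 𝕜)) P ∈
      IntermediateField.adjoin 𝕜 (Set.range fun p : ℕ × ℕ => tresseCoeff 𝕜 p.1 p.2) := by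
  set L := IntermediateField.adjoin 𝕜 (Set.range fun p : ℕ × ℕ => tresseCoeff 𝕜 p.1 p.2)
  have hz : ∀ v, framedJet 𝕜 v ∈ L := by
    intro v
    cases v with
    | x => exact L.zero_mem
    | y => exact L.zero_mem
    | u i j => exact IntermediateField.subset_adjoin _ _ ⟨(i, j), rfl⟩
  let z : JetVar → L := fun v => ⟨framedJet 𝕜 v, hz v⟩
  let w : JetVar → L := prolong (algebraMap 𝕜 L s) (algebraMap 𝕜 L t) (algebraMap 𝕜 L a)
    (algebraMap 𝕜 L b) (algebraMap 𝕜 L c) (algebraMap 𝕜 L d) z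
  have e : prolong (algebraMap 𝕜 (JetField 𝕜) s) (algebraMap 𝕜 (JetField 𝕜) t)
      (algebraMap 𝕜 (JetField 𝕜) a) (algebraMap 𝕜 (JetField 𝕜) b) (algebraMap 𝕜 (JetField 𝕜) c)
      (algebraMap 𝕜 (JetField 𝕜) d) (framedJet 𝕜) = fun v => L.val (w v) := by
    funext v
    exact (map_prolong (algebraMap L (JetField 𝕜)) (algebraMap 𝕜 L s) (algebraMap 𝕜 L t)
      (algebraMap 𝕜 L a) (algebraMap 𝕜 L b) (algebraMap 𝕜 L c) (algebraMap 𝕜 L d) z v).symm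
  rw [e, ← comp_aeval_apply w L.val P]
  exact Subtype.property _

theorem IsAffineInvariant.mem_adjoin {F : JetField 𝕜} (hF : IsAffineInvariant F) :
    F ∈ IntermediateField.adjoin 𝕜 (Set.range fun p : ℕ × ℕ => tresseCoeff 𝕜 p.1 p.2) := by
  obtain ⟨P, Q, hQ, rfl⟩ := IsFractionRing.div_surjective (A := JetPoly 𝕜) F
  have hQ0 : Q ≠ 0 := nonZeroDivisors.ne_zero hQ
  have hid := hF.generic_identity hQ0
  let U : JetVar → JetField 𝕜 := fun v => algebraMap (JetPoly 𝕜) (JetField 𝕜) (X v)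
  have hU : ∀ P : JetPoly 𝕜, aeval U P = algebraMap (JetPoly 𝕜) (JetField 𝕜) P := by
    intro P
    have := comp_aeval_apply (R := 𝕜) X (Algebra.algHom 𝕜 (JetPoly 𝕜) (JetField 𝕜)) P
    rw [aeval_X_left_apply] at this
    exact this.symm
  -- The denominator at the framed jet, moved by a generic affine map.
  let R : MvPolynomial (Fin 6) (JetField 𝕜) :=
    aeval (prolong (X 4) (X 5) (X 0) (X 1) (X 2) (X 3) fun v => C (framedJet 𝕜 v)) Q
  have hR : ∀ g : Fin 6 → JetField 𝕜, eval g R =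
      aeval (prolong (g 4) (g 5) (g 0) (g 1) (g 2) (g 3) (framedJet 𝕜)) Q := by
    intro g
    have := comp_aeval_apply (R := 𝕜)
      (prolong (X 4) (X 5) (X 0) (X 1) (X 2) (X 3) fun v => C (framedJet 𝕜 v))
      ((aeval g : MvPolynomial (Fin 6) (JetField 𝕜) →ₐ[JetField 𝕜] JetField 𝕜).restrictScalars 𝕜) Q
    refine (show eval g R = _ from this).trans ?_
    congr 2
    funext v
    refine (map_prolong (eval g) _ _ _ _ _ _ _ v).trans ?_
    simp
  have hR0 : R ≠ 0 := by
    intro h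
    have := hR ![u 𝕜 1 0, extendDer (polyDx 𝕜) (I2 𝕜), u 𝕜 0 1, extendDer (polyDy 𝕜) (I2 𝕜),
      U .x, U .y]
    rw [h, map_zero] at this
    refine algebraMap_ne_zero hQ0 ?_
    rw [← hU, this]
    congr 2
    exact prolong_coframe_framedJet.symm
  obtain ⟨g, hg⟩ : ∃ g : Fin 6 → 𝕜, eval (fun k => algebraMap 𝕜 (JetField 𝕜) (g k)) R ≠ 0 := by
    by_contra! hall
    refine hR0 (funext_set (fun _ => Set.range (algebraMap 𝕜 (JetField 𝕜)))
      (fun _ => Set.infinite_range_of_injective (algebraMap 𝕜 (JetField 𝕜)).injective)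
      fun w hw => ?_)
    choose g hg using fun k => hw k trivial
    rw [map_zero, ← hall g]
    congr 2
    exact (funext hg).symm
  rw [hR] at hg
  -- The composite of the coframe with the chosen map over the ground field.
  obtain ⟨k, hk⟩ : ∃ k : Fin 6 → JetField 𝕜, prolong (k 4) (k 5) (k 0) (k 1) (k 2) (k 3) U =
      prolong (algebraMap 𝕜 (JetField 𝕜) (g 4)) (algebraMap 𝕜 (JetField 𝕜) (g 5))
        (algebraMap 𝕜 (JetField 𝕜) (g 0)) (algebraMap 𝕜 (JetField 𝕜) (g 1))
        (algebraMap 𝕜 (JetField 𝕜) (g 2)) (algebraMap 𝕜 (JetField 𝕜) (g 3)) (framedJet 𝕜) := by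
    rw [framedJet, prolong_prolong]
    exact ⟨![_, _, _, _, _, _], rfl⟩
  have hid' := congrArg (aeval (Sum.elim U k)) hid
  rw [map_mul, map_mul, algHom_aeval_genericProlong, algHom_aeval_genericProlong,
    aeval_rename_inl, aeval_rename_inl, hU, hU, hk] at hid'
  have hF' : algebraMap (JetPoly 𝕜) (JetField 𝕜) P / algebraMap (JetPoly 𝕜) (JetField 𝕜) Q = _ :=
    (div_eq_div_iff (algebraMap_ne_zero hQ0) hg).mpr ((mul_comm _ _).trans hid'.symm)
  rw [hF']
  exact div_mem (aeval_prolong_framedJet_mem _ _ _ _ _ _ P)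
    (aeval_prolong_framedJet_mem _ _ _ _ _ _ Q)

end InvariantIsRational

end AffJet

end

theorem mainTheorem7 (𝕜 : Type*) [RCLike 𝕜] :
    LinearIndependent (AffJet.JetField 𝕜) ![AffJet.omega1 𝕜, AffJet.omega2 𝕜] ∧
    ∃ I : ℕ → ℕ → AffJet.JetField 𝕜,
      AffJet.AreTresseCoeffs I ∧
      (∀ I' : ℕ → ℕ → AffJet.JetField 𝕜, AffJet.AreTresseCoeffs I' → I' = I) ∧
      ∀ F : AffJet.JetField 𝕜, AffJet.IsAffineInvariant F ↔
        F ∈ IntermediateField.adjoin 𝕜 (Set.range fun p : ℕ × ℕ => I p.1 p.2) :=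
  ⟨AffJet.coframe_linearIndependent 𝕜, AffJet.tresseCoeff 𝕜, AffJet.areTresseCoeffs_tresseCoeff 𝕜,
    fun _ h => h.eq_tresseCoeff,
    fun _ => ⟨fun h => h.mem_adjoin, AffJet.isAffineInvariant_of_mem_adjoin⟩⟩
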